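/- Let $n\ge 0$ be an integer. Let $STVB_n$ (the singular twisted virtual braid monoid) be the monoid with generators $\sigma_i,\sigma_i^{-1},\rho_i,\tau_i$ ($1\le i\le n-1$) and $\gamma_j$ ($1\le j\le n$) and defining relations - $\sigma_i\sigma_i^{-1}=\sigma_i^{-1}\sigma_i=e$, $\rho_i^2=e$, $\gamma_j^2=e$, $\gamma_i\gamma_j=\gamma_j\gamma_i$ for all $i,j$; - $\sigma_i\sigma_j=\sigma_j\sigma_i$, $\rho_i\rho_j=\rho_j\rho_i$, $\tau_i\tau_j=\tau_j\tau_i$, $\sigma_i\rho_j=\rho_j\sigma_i$, $\sigma_i\tau_j=\tau_j\sigma_i$, $\tau_i\rho_j=\rho_j\tau_i$ for $|i-j|>1$, and $\sigma_i\tau_i=\tau_i\sigma_i$; - $\sigma_i\sigma_{i+1}\sigma_i=\sigma_{i+1}\sigma_i\sigma_{i+1}$, $\rho_i\rho_{i+1}\rho_i=\rho_{i+1}\rho_i\rho_{i+1}$, $\rho_i\sigma_{i+1}\rho_i=\rho_{i+1}\sigma_i\rho_{i+1}$, $\rho_i\tau_{i+1}\rho_i=\rho_{i+1}\tau_i\rho_{i+1}$,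 $\sigma_i\sigma_{i+1}\tau_i=\tau_{i+1}\sigma_i\sigma_{i+1}$, $\sigma_{i+1}\sigma_i\tau_{i+1}=\tau_i\sigma_{i+1}\sigma_i$ for $1\le i\le n-2$; - $\gamma_j\rho_i=\rho_i\gamma_j$, $\sigma_i\gamma_j=\gamma_j\sigma_i$, $\tau_i\gamma_j=\gamma_j\tau_i$ for $j\ne i,i+1$, and $\gamma_{i+1}\rho_i=\rho_i\gamma_i$; - $\rho_i\sigma_i\rho_i=\gamma_{i+1}\gamma_i\sigma_i\gamma_i\gamma_{i+1}$ and $\rho_i\tau_i\rho_i=\gamma_{i+1}\gamma_i\tau_i\gamma_i\gamma_{i+1}$. Let $\varphi_1\colon STVB_n\to S_n$ be the homomorphism sending $\sigma_i^{\pm1},\tau_i,\rho_i$ to the transposition $(i,i+1)$ and every $\gamma_j$ to the identity, and let $STVP_n=\ker\varphi_1=\{w : \varphi_1(w)=e\}$, a submonoid of $STVB_n$. Put $\lambda_{i,i+1}=\rho_i\sigma_i^{-1}$, $\lambda_{i,i+1}^{-1}=\sigma_i\rho_i$, $y_{i,i+1}=\rho_i\tau_i$ and, for $x\in\{\lambda,\lambda^{-1},y\}$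 and $i<j$, $$x_{i+1,i}=\rho_i x_{i,i+1}\rho_i,\qquad x_{ij}=\rho_{j-1}\cdots\rho_{i+1}\,x_{i,i+1}\,\rho_{i+1}\cdots\rho_{j-1},\qquad x_{ji}=\rho_{j-1}\cdots\rho_{i+1}\,x_{i+1,i}\,\rho_{i+1}\cdots\rho_{j-1}.$$ **Theorem.** The monoid $STVP_n$ has the monoid presentation with generators $\lambda_{kl},\lambda_{kl}^{-1},y_{kl}$ ($1\le k\ne l\le n$) and $\gamma_j$ ($1\le j\le n$) (the letters standing for the elements of the same name) and defining relations $\gamma_i^2=e$, $\gamma_i\gamma_j=\gamma_j\gamma_i$ and $$\begin{aligned} &\lambda_{ij}\lambda_{ij}^{-1}=\lambda_{ij}^{-1}\lambda_{ij}=e, &&\lambda_{ij}\lambda_{kl}=\lambda_{kl}\lambda_{ij}, \\ &\lambda_{ki}(\lambda_{kj}\lambda_{ij})=(\lambda_{ij}\lambda_{kj})\lambda_{ki}, &&\lambda_{ij}\gamma_k=\gamma_k\lambda_{ij},\\ &\lambda_{ij}=\gamma_i\gamma_j\lambda_{ji}\gamma_j\gamma_i, &&y_{ij}y_{kl}=y_{kl}y_{ij},\\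 &\lambda_{ij}y_{kl}=y_{kl}\lambda_{ij}, &&\lambda_{ki}(\lambda_{kj}y_{ij})=(y_{ij}\lambda_{kj})\lambda_{ki},\\ &y_{kl}\lambda_{lk}=\lambda_{kl}y_{lk}, &&y_{ki}(\lambda_{kj}\lambda_{ij})=(\lambda_{ij}\lambda_{kj})y_{ki},\\ &y_{ij}\gamma_k=\gamma_ky_{ij}, &&y_{ij}=\gamma_i\gamma_jy_{ji}\gamma_j\gamma_i, \end{aligned}$$ where in the displayed relations different letters stand for different indices. That is, sending each letter to the element of the same name defines an isomorphism from the monoid so presented onto $STVP_n$. -/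

import Mathlib

/-!  Strands are numbered by `Fin n` and crossings by `Fin (n - 1)`: the crossing `i` involves the
strands `i` and `i + 1` (everything is numbered from `0`). -/

namespace STVB

/-- The generators `σ_i`, `σ_i⁻¹`, `ρ_i`, `τ_i` (`n - 1` of each) and `γ_j` (`n` of them). -/
inductive Gen (n : ℕ) : Type
  | sigma (i : Fin (n - 1))
  | sigmaInv (i : Fin (n - 1))
  | rho (i : Fin (n - 1))
  | tau (i : Fin (n - 1))
  | gamma (j : Fin n)

/-- The strand `i`, as the first of the two strands of the crossing `i`. -/
def fst {n : ℕ} (i : Fin (n - 1)) : Fin n := ⟨i, by omega⟩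

/-- The strand `i + 1`, as the second of the two strands of the crossing `i`. -/
def snd {n : ℕ} (i : Fin (n - 1)) : Fin n := ⟨i + 1, by omega⟩

/-- The crossings `i` and `j` are far apart: `|i - j| > 1`. -/
def Far {n : ℕ} (i j : Fin (n - 1)) : Prop := 1 < |(i : ℤ) - (j : ℤ)|

/-- The letters, as words of length one. -/
abbrev wσ {n : ℕ} (i : Fin (n - 1)) : FreeMonoid (Gen n) := FreeMonoid.of (Gen.sigma i)
abbrev wσi {n : ℕ} (i : Fin (n - 1)) : FreeMonoid (Gen n) := FreeMonoid.of (Gen.sigmaInv i)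
abbrev wρ {n : ℕ} (i : Fin (n - 1)) : FreeMonoid (Gen n) := FreeMonoid.of (Gen.rho i)
abbrev wτ {n : ℕ} (i : Fin (n - 1)) : FreeMonoid (Gen n) := FreeMonoid.of (Gen.tau i)
abbrev wγ {n : ℕ} (j : Fin n) : FreeMonoid (Gen n) := FreeMonoid.of (Gen.gamma j)

/-- The defining relations of the singular twisted virtual braid monoid.  In the relations that
involve two neighbouring crossings, `j` stands for `i + 1`. -/
inductive Rel (n : ℕ) : FreeMonoid (Gen n) → FreeMonoid (Gen n) → Prop
  | sigma_far (i j : Fin (n - 1)) (h : Far i j) : Rel n (wσ i * wσ j) (wσ j * wσ i)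
  | sigma_braid (i j : Fin (n - 1)) (h : (j : ℕ) = i + 1) :
      Rel n (wσ i * wσ j * wσ i) (wσ j * wσ i * wσ j)
  | rho_sq (i : Fin (n - 1)) : Rel n (wρ i * wρ i) 1
  | rho_far (i j : Fin (n - 1)) (h : Far i j) : Rel n (wρ i * wρ j) (wρ j * wρ i)
  | rho_braid (i j : Fin (n - 1)) (h : (j : ℕ) = i + 1) :
      Rel n (wρ i * wρ j * wρ i) (wρ j * wρ i * wρ j)
  | sigma_rho_far (i j : Fin (n - 1)) (h : Far i j) : Rel n (wσ i * wρ j) (wρ j * wσ i)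
  | rho_sigma_rho (i j : Fin (n - 1)) (h : (j : ℕ) = i + 1) :
      Rel n (wρ i * wσ j * wρ i) (wρ j * wσ i * wρ j)
  | gamma_sq (i : Fin n) : Rel n (wγ i * wγ i) 1
  | gamma_comm (i j : Fin n) : Rel n (wγ i * wγ j) (wγ j * wγ i)
  | gamma_rho_far (i : Fin (n - 1)) (j : Fin n) (h : j ≠ fst i) (h' : j ≠ snd i) :
      Rel n (wγ j * wρ i) (wρ i * wγ j)
  | sigma_gamma_far (i : Fin (n - 1)) (j : Fin n) (h : j ≠ fst i) (h' : j ≠ snd i) :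
      Rel n (wσ i * wγ j) (wγ j * wσ i)
  | gamma_rho (i : Fin (n - 1)) : Rel n (wγ (snd i) * wρ i) (wρ i * wγ (fst i))
  | sigma_twist (i : Fin (n - 1)) :
      Rel n (wρ i * wσ i * wρ i) (wγ (snd i) * wγ (fst i) * wσ i * wγ (fst i) * wγ (snd i))
  | sigma_mul_inv (i : Fin (n - 1)) : Rel n (wσ i * wσi i) 1
  | sigma_inv_mul (i : Fin (n - 1)) : Rel n (wσi i * wσ i) 1
  | tau_far (i j : Fin (n - 1)) (h : Far i j) : Rel n (wτ i * wτ j) (wτ j * wτ i)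
  | sigma_tau_far (i j : Fin (n - 1)) (h : Far i j) : Rel n (wσ i * wτ j) (wτ j * wσ i)
  | sigma_tau (i : Fin (n - 1)) : Rel n (wσ i * wτ i) (wτ i * wσ i)
  | sigma_sigma_tau (i j : Fin (n - 1)) (h : (j : ℕ) = i + 1) :
      Rel n (wσ i * wσ j * wτ i) (wτ j * wσ i * wσ j)
  | sigma_sigma_tau' (i j : Fin (n - 1)) (h : (j : ℕ) = i + 1) :
      Rel n (wσ j * wσ i * wτ j) (wτ i * wσ j * wσ i)
  | tau_rho_far (i j : Fin (n - 1)) (h : Far i j) : Rel n (wτ i * wρ j) (wρ j * wτ i)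
  | rho_tau_rho (i j : Fin (n - 1)) (h : (j : ℕ) = i + 1) :
      Rel n (wρ i * wτ j * wρ i) (wρ j * wτ i * wρ j)
  | tau_gamma_far (i : Fin (n - 1)) (j : Fin n) (h : j ≠ fst i) (h' : j ≠ snd i) :
      Rel n (wτ i * wγ j) (wγ j * wτ i)
  | tau_twist (i : Fin (n - 1)) :
      Rel n (wρ i * wτ i * wρ i) (wγ (snd i) * wγ (fst i) * wτ i * wγ (fst i) * wγ (snd i))

end STVB

/-- The singular twisted virtual braid monoid on `n` strands. -/
abbrev STVB (n : ℕ) : Type := PresentedMonoid (STVB.Rel n)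

namespace STVB

/-- The generators, as elements of the monoid. -/
def σ {n : ℕ} (i : Fin (n - 1)) : STVB n := PresentedMonoid.of (Rel n) (Gen.sigma i)
def σInv {n : ℕ} (i : Fin (n - 1)) : STVB n := PresentedMonoid.of (Rel n) (Gen.sigmaInv i)
def ρ {n : ℕ} (i : Fin (n - 1)) : STVB n := PresentedMonoid.of (Rel n) (Gen.rho i)
def τ {n : ℕ} (i : Fin (n - 1)) : STVB n := PresentedMonoid.of (Rel n) (Gen.tau i)
def γ {n : ℕ} (j : Fin n) : STVB n := PresentedMonoid.of (Rel n) (Gen.gamma j)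

/-- The values of `φ₁` on the generators: crossings of any kind give the transposition
`(i, i + 1)`, bars give the identity. -/
def permOfGen {n : ℕ} : Gen n → Equiv.Perm (Fin n)
  | Gen.sigma i => Equiv.swap (fst i) (snd i)
  | Gen.sigmaInv i => Equiv.swap (fst i) (snd i)
  | Gen.rho i => Equiv.swap (fst i) (snd i)
  | Gen.tau i => Equiv.swap (fst i) (snd i)
  | Gen.gamma _ => 1

theorem swap_far {n : ℕ} (i j : Fin (n - 1)) (h : Far i j) :
    Equiv.swap (fst i) (snd i) * Equiv.swap (fst j) (snd j)
      = Equiv.swap (fst j) (snd j) * Equiv.swap (fst i) (snd i) := by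
  unfold Far at h
  rw [lt_abs] at h
  ext x
  simp only [Equiv.Perm.mul_apply, Equiv.swap_apply_def, fst, snd, Fin.ext_iff]
  grind

theorem swap_braid {n : ℕ} (i j : Fin (n - 1)) (h : (j : ℕ) = i + 1) :
    Equiv.swap (fst i) (snd i) * Equiv.swap (fst j) (snd j) * Equiv.swap (fst i) (snd i)
      = Equiv.swap (fst j) (snd j) * Equiv.swap (fst i) (snd i) * Equiv.swap (fst j) (snd j) := by
  ext x
  simp only [Equiv.Perm.mul_apply, Equiv.swap_apply_def, fst, snd, Fin.ext_iff]
  grind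

theorem permOfGen_rel {n : ℕ} (a b : FreeMonoid (Gen n)) (h : Rel n a b) :
    FreeMonoid.lift permOfGen a = FreeMonoid.lift permOfGen b := by
  cases h <;> simp [permOfGen] <;> first | (apply swap_far; assumption) | (apply swap_braid; assumption) |
    (symm; apply swap_braid; assumption)

/-- The homomorphism `φ₁` onto the symmetric group. -/
def φ₁ (n : ℕ) : STVB n →* Equiv.Perm (Fin n) := PresentedMonoid.lift permOfGen permOfGen_rel

/-- `conjρ x i d` is `ρ_{j-1} ρ_{j-2} ⋯ ρ_{i+1} x ρ_{i+1} ⋯ ρ_{j-2} ρ_{j-1}` for `j = i + d + 1`. -/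
def conjρ {n : ℕ} (x : STVB n) (i : ℕ) : (d : ℕ) → i + d + 1 < n → STVB n
  | 0, _ => x
  | d + 1, h => ρ ⟨i + d + 1, by omega⟩ * conjρ x i d (by omega) * ρ ⟨i + d + 1, by omega⟩

/-- From elements `x_{i,i+1}` (given by `a i`) the elements `x_{kl}`, `k ≠ l`:
`x_{i+1,i} = ρ_i x_{i,i+1} ρ_i` and, for `i < j`,
`x_{ij} = ρ_{j-1} ⋯ ρ_{i+1} x_{i,i+1} ρ_{i+1} ⋯ ρ_{j-1}`,
`x_{ji} = ρ_{j-1} ⋯ ρ_{i+1} x_{i+1,i} ρ_{i+1} ⋯ ρ_{j-1}`. -/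
def spread {n : ℕ} (a : Fin (n - 1) → STVB n) (k l : Fin n) (hkl : k ≠ l) : STVB n :=
  if h : k < l then
    conjρ (a ⟨k, by omega⟩) k (l - k - 1) (by omega)
  else
    conjρ (ρ ⟨l, by omega⟩ * a ⟨l, by omega⟩ * ρ ⟨l, by omega⟩) l (k - l - 1) (by omega)

/-- `λ_{kl}`, with `λ_{i,i+1} = ρ_i σ_i⁻¹`. -/
def lam {n : ℕ} (k l : Fin n) (h : k ≠ l) : STVB n := spread (fun i => ρ i * σInv i) k l h

/-- `λ_{kl}⁻¹`, with `λ_{i,i+1}⁻¹ = σ_i ρ_i`. -/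
def lamInv {n : ℕ} (k l : Fin n) (h : k ≠ l) : STVB n := spread (fun i => σ i * ρ i) k l h

/-- `y_{kl}`, with `y_{i,i+1} = ρ_i τ_i`. -/
def y {n : ℕ} (k l : Fin n) (h : k ≠ l) : STVB n := spread (fun i => ρ i * τ i) k l h

end STVB

/-- The singular twisted virtual pure braid monoid: the kernel of `φ₁`. -/
def STVP (n : ℕ) : Submonoid (STVB n) := MonoidHom.mker (STVB.φ₁ n)

namespace STVP

/-- The letters `λ_{kl}`, `λ_{kl}⁻¹`, `y_{kl}` (`k ≠ l`) and `γ_j`. -/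
inductive Gen (n : ℕ) : Type
  | lam (k l : Fin n) (h : k ≠ l)
  | lamInv (k l : Fin n) (h : k ≠ l)
  | y (k l : Fin n) (h : k ≠ l)
  | gamma (j : Fin n)

abbrev wL {n : ℕ} (k l : Fin n) (h : k ≠ l) : FreeMonoid (Gen n) := FreeMonoid.of (Gen.lam k l h)
abbrev wLi {n : ℕ} (k l : Fin n) (h : k ≠ l) : FreeMonoid (Gen n) :=
  FreeMonoid.of (Gen.lamInv k l h)
abbrev wY {n : ℕ} (k l : Fin n) (h : k ≠ l) : FreeMonoid (Gen n) := FreeMonoid.of (Gen.y k l h)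
abbrev wG {n : ℕ} (j : Fin n) : FreeMonoid (Gen n) := FreeMonoid.of (Gen.gamma j)

/-- The relations of the presentation of the pure monoid.  Different letters stand for different
indices, except in `γ_i γ_j = γ_j γ_i`. -/
inductive Rel (n : ℕ) : FreeMonoid (Gen n) → FreeMonoid (Gen n) → Prop
  | gamma_sq (i : Fin n) : Rel n (wG i * wG i) 1
  | gamma_comm (i j : Fin n) : Rel n (wG i * wG j) (wG j * wG i)
  | lam_mul_inv (i j : Fin n) (ij : i ≠ j) : Rel n (wL i j ij * wLi i j ij) 1
  | lam_inv_mul (i j : Fin n) (ij : i ≠ j) : Rel n (wLi i j ij * wL i j ij) 1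
  | lam_lam (i j k l : Fin n) (ij : i ≠ j) (kl : k ≠ l)
      (ik : i ≠ k) (il : i ≠ l) (jk : j ≠ k) (jl : j ≠ l) :
      Rel n (wL i j ij * wL k l kl) (wL k l kl * wL i j ij)
  | lam_lam_lam (i j k : Fin n) (ij : i ≠ j) (ki : k ≠ i) (kj : k ≠ j) :
      Rel n (wL k i ki * (wL k j kj * wL i j ij)) ((wL i j ij * wL k j kj) * wL k i ki)
  | lam_gamma (i j k : Fin n) (ij : i ≠ j) (ki : k ≠ i) (kj : k ≠ j) :
      Rel n (wL i j ij * wG k) (wG k * wL i j ij)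
  | lam_twist (i j : Fin n) (ij : i ≠ j) :
      Rel n (wL i j ij) (wG i * wG j * wL j i ij.symm * wG j * wG i)
  | y_y (i j k l : Fin n) (ij : i ≠ j) (kl : k ≠ l)
      (ik : i ≠ k) (il : i ≠ l) (jk : j ≠ k) (jl : j ≠ l) :
      Rel n (wY i j ij * wY k l kl) (wY k l kl * wY i j ij)
  | lam_y (i j k l : Fin n) (ij : i ≠ j) (kl : k ≠ l)
      (ik : i ≠ k) (il : i ≠ l) (jk : j ≠ k) (jl : j ≠ l) :
      Rel n (wL i j ij * wY k l kl) (wY k l kl * wL i j ij)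
  | lam_lam_y (i j k : Fin n) (ij : i ≠ j) (ki : k ≠ i) (kj : k ≠ j) :
      Rel n (wL k i ki * (wL k j kj * wY i j ij)) ((wY i j ij * wL k j kj) * wL k i ki)
  | y_lam (k l : Fin n) (kl : k ≠ l) :
      Rel n (wY k l kl * wL l k kl.symm) (wL k l kl * wY l k kl.symm)
  | y_lam_lam (i j k : Fin n) (ij : i ≠ j) (ki : k ≠ i) (kj : k ≠ j) :
      Rel n (wY k i ki * (wL k j kj * wL i j ij)) ((wL i j ij * wL k j kj) * wY k i ki)
  | y_gamma (i j k : Fin n) (ij : i ≠ j) (ki : k ≠ i) (kj : k ≠ j) :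
      Rel n (wY i j ij * wG k) (wG k * wY i j ij)
  | y_twist (i j : Fin n) (ij : i ≠ j) :
      Rel n (wY i j ij) (wG i * wG j * wY j i ij.symm * wG j * wG i)

end STVP

/-! The braid monoid is a semidirect product of the pure monoid with the symmetric group generated
by the `ρ i`. Let `P` be the abstractly presented monoid. Permutations act on `P` by renumbering
strands, because the relations are symmetric in the indices. In the braid monoid, conjugation by `ρ
i` renumbers the elements λ, λ⁻¹, y, γ in the same way (`conj_spreadChain`, `ρ_mul_evalGen`).

Since `σ i = λ⁻¹_{i,i+1} ρ i`, `σ i ⁻¹ = ρ i λ_{i,i+1}` and `τ i = y_{i+1,i} ρ i`, every defining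
relation of the braid monoid becomes, once the permutations are moved to the right, a relation
between pure words times an equality of permutations. This translation is used in both directions.
Read one way (`opGen_rel`), it makes the braid monoid act on `P`, pure letters by left
multiplication and `ρ i` by renumbering. Read the other way (`evalGen_rel`), it shows that the pure
relations hold in the braid monoid for some neighbouring strands; renumbering gives them for all
indices, so `evalHom` is defined on `P`.

Injectivity: acting through `evalHom` is left multiplication on `P`, which is faithful because it
can be evaluated at `1`. Surjectivity onto the kernel: every element is a pure element times a
product `r` of the `ρ i` (`exists_eq_evalHom_mul`). If the element lies in the kernel, then `r` has
trivial permutation, and `r = 1` because the Coxeter relations already present the symmetric group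
(`eq_one_of_perm_eq_one`). -/

/-! ### Coxeter generators acting on elements indexed by pairs of strands -/

/-- Elements `r 0, …, r (N - 1)` satisfying the Coxeter relations of the symmetric group. -/
structure IsCoxeterA {M : Type*} [Monoid M] (N : ℕ) (r : ℕ → M) : Prop where
  sq : ∀ i < N, r i * r i = 1
  far : ∀ i j, i + 1 < j → j < N → r i * r j = r j * r i
  braid : ∀ i, i + 1 < N → r i * r (i + 1) * r i = r (i + 1) * r i * r (i + 1)

/-- A family `b 0, …, b (N - 1)` on which conjugation by the `r i` acts as on adjacent pairs. -/
structure IsAdjacentFamily {M : Type*} [Monoid M] (N : ℕ) (r b : ℕ → M) : Prop where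
  far : ∀ i j, i < N → j < N → (i + 1 < j ∨ j + 1 < i) → r i * b j = b j * r i
  braid : ∀ i, i + 1 < N → r i * b (i + 1) * r i = r (i + 1) * b i * r (i + 1)

/-- `r (i + d) ⋯ r (i + 1) * x * r (i + 1) ⋯ r (i + d)`. -/
def conjChain {M : Type*} [Monoid M] (r : ℕ → M) (x : M) (i : ℕ) : ℕ → M
  | 0 => x
  | d + 1 => r (i + d + 1) * conjChain r x i d * r (i + d + 1)

theorem conj_eq_iff_of_sq {M : Type*} [Monoid M] {r x y : M} (h : r * r = 1) :
    r * x * r = y ↔ r * x = y * r := by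
  constructor
  · rintro rfl
    rw [mul_assoc _ r r, h, mul_one]
  · intro e
    rw [e, mul_assoc, h, mul_one]

theorem conj_conj_of_sq {M : Type*} [Monoid M] {r x : M} (h : r * r = 1) :
    r * (r * x * r) * r = x := by
  rw [show r * (r * x * r) * r = (r * r) * x * (r * r) by simp only [mul_assoc], h, one_mul,
    mul_one]

namespace IsCoxeterA

variable {M : Type*} [Monoid M] {N : ℕ} {r b : ℕ → M}

theorem comm (H : IsCoxeterA N r) {i j : ℕ} (hi : i < N) (hj : j < N)
    (h : i + 1 < j ∨ j + 1 < i) : r i * r j = r j * r i := by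
  rcases h with h | h
  · exact H.far i j h hj
  · exact (H.far j i h hi).symm

theorem adjacentFamily_self (H : IsCoxeterA N r) : IsAdjacentFamily N r r where
  far _ _ hi hj h := H.comm hi hj h
  braid := H.braid

theorem adjacentFamily_mul (H : IsCoxeterA N r) {b c : ℕ → M} (hb : IsAdjacentFamily N r b)
    (hc : IsAdjacentFamily N r c) : IsAdjacentFamily N r (fun i => b i * c i) where
  far i j hi hj h := by
    rw [← mul_assoc, hb.far i j hi hj h, mul_assoc, hc.far i j hi hj h, mul_assoc]
  braid i hi := by
    have key : ∀ {s x y : M}, s * s = 1 → s * (x * y) * s = (s * x * s) * (s * y * s) := by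
      intro s x y hs
      rw [show (s * x * s) * (s * y * s) = s * x * (s * s) * y * s by simp only [mul_assoc], hs]
      simp only [mul_assoc, mul_one]
    rw [key (H.sq i (by omega)), key (H.sq (i + 1) hi), hb.braid i hi, hc.braid i hi]

/-- Conjugating by a reflection on strands outside, or at distance from, the pair. -/
theorem conjChain_comm_outside (H : IsCoxeterA N r) (hb : IsAdjacentFamily N r b) (i m : ℕ)
    (hm : m < N) : ∀ d, i + d < N → (m + 1 < i ∨ i + d + 1 < m) →
      r m * conjChain r (b i) i d = conjChain r (b i) i d * r m
  | 0, hd, h => by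
    simp only [conjChain]
    exact hb.far m i hm (by omega) (by omega)
  | d + 1, hd, h => by
    have ih := conjChain_comm_outside H hb i m hm d (by omega) (by omega)
    have e : r m * r (i + d + 1) = r (i + d + 1) * r m := H.comm hm (by omega) (by omega)
    simp only [conjChain]
    calc r m * (r (i + d + 1) * conjChain r (b i) i d * r (i + d + 1))
        = (r m * r (i + d + 1)) * conjChain r (b i) i d * r (i + d + 1) := by
          simp only [mul_assoc]
      _ = r (i + d + 1) * (r m * conjChain r (b i) i d) * r (i + d + 1) := by
          rw [e]; simp only [mul_assoc]
      _ = r (i + d + 1) * conjChain r (b i) i d * (r m * r (i + d + 1)) := by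
          rw [ih]; simp only [mul_assoc]
      _ = _ := by rw [e]; simp only [mul_assoc]

/-- The outer factors far from `m` commute with `r m` and are stripped off. This leaves the chain `q
p X p q` with `p = r m`, `q = r (m + 1)` and `X` commuting with `q`; the braid relation, applied
once on each side of `X`, carries `p` across. -/
theorem conjChain_comm_inside (H : IsCoxeterA N r) (hb : IsAdjacentFamily N r b) (i m : ℕ)
    (hm : i < m) : ∀ d, i + d < N → m < i + d →
      r m * conjChain r (b i) i d = conjChain r (b i) i d * r m
  | 0, hd, h => by omega
  | d + 1, hd, h => by
    rcases Nat.lt_or_ge m (i + d) with h' | h'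
    · have ih := conjChain_comm_inside H hb i m hm d (by omega) (by omega)
      have e : r m * r (i + d + 1) = r (i + d + 1) * r m := H.comm (by omega) (by omega) (by omega)
      simp only [conjChain]
      calc r m * (r (i + d + 1) * conjChain r (b i) i d * r (i + d + 1))
          = (r m * r (i + d + 1)) * conjChain r (b i) i d * r (i + d + 1) := by
            simp only [mul_assoc]
        _ = r (i + d + 1) * (r m * conjChain r (b i) i d) * r (i + d + 1) := by
            rw [e]; simp only [mul_assoc]
        _ = r (i + d + 1) * conjChain r (b i) i d * (r m * r (i + d + 1)) := by
            rw [ih]; simp only [mul_assoc]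
        _ = _ := by rw [e]; simp only [mul_assoc]
    · obtain ⟨e, rfl⟩ : ∃ e, d = e + 1 := ⟨d - 1, by omega⟩
      obtain rfl : m = i + e + 1 := by omega
      have hc := conjChain_comm_outside H hb i (i + e + 1 + 1) (by omega) e (by omega) (by omega)
      have hbr := H.braid (i + e + 1) (by omega)
      simp only [conjChain, ← add_assoc]
      set p := r (i + e + 1)
      set q := r (i + e + 1 + 1)
      set X := conjChain r (b i) i e
      calc p * (q * (p * X * p) * q) = (p * q * p) * X * p * q := by simp only [mul_assoc]
        _ = q * p * (q * X) * p * q := by rw [hbr]; simp only [mul_assoc]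
        _ = q * p * X * (q * p * q) := by rw [hc]; simp only [mul_assoc]
        _ = _ := by rw [← hbr]; simp only [mul_assoc]

/-- Chains grow by definition at the upper end; growth at the lower end comes from the braid
condition on the family, since the later factors commute with `r i`. -/
theorem conj_conjChain_left (H : IsCoxeterA N r) (hb : IsAdjacentFamily N r b) (i : ℕ) :
    ∀ d, i + 1 + d < N →
      r i * conjChain r (b (i + 1)) (i + 1) d * r i = conjChain r (b i) i (d + 1)
  | 0, hd => by
    simp only [conjChain]
    exact hb.braid i (by omega)
  | d + 1, hd => by
    have ih := conj_conjChain_left H hb i d (by omega)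
    have e : r i * r (i + 1 + d + 1) = r (i + 1 + d + 1) * r i :=
      H.comm (by omega) (by omega) (by omega)
    rw [conjChain, conjChain, show i + (d + 1) + 1 = i + 1 + d + 1 by omega, ← ih]
    calc r i * (r (i + 1 + d + 1) * conjChain r (b (i + 1)) (i + 1) d * r (i + 1 + d + 1)) * r i
        = (r i * r (i + 1 + d + 1)) * conjChain r (b (i + 1)) (i + 1) d *
            (r (i + 1 + d + 1) * r i) := by simp only [mul_assoc]
      _ = _ := by rw [← e]; nth_rewrite 1 [e]; simp only [mul_assoc]

/-- The element attached to the pair `(k, l)`, `k ≠ l`. -/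
def _root_.spreadChain {M : Type*} [Monoid M] (r b : ℕ → M) (k l : ℕ) : M :=
  if k < l then conjChain r (b k) k (l - k - 1)
  else conjChain r (r l * b l * r l) l (k - l - 1)

/-- If `m` or `m + 1` is an endpoint of the pair, conjugation lengthens or shortens the chain by one
step at that end. Otherwise both endpoints are fixed and `r m` commutes with the chain. The excluded
pair `(m, m + 1)` is the one whose order would be reversed. -/
theorem conj_conjChain_swap (H : IsCoxeterA N r) (hb : IsAdjacentFamily N r b) (i j m : ℕ)
    (hij : i < j) (hj : j ≤ N) (hm : m < N) (h : i ≠ m ∨ j ≠ m + 1) :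
    r m * conjChain r (b i) i (j - i - 1) * r m =
      conjChain r (b (Equiv.swap m (m + 1) i)) (Equiv.swap m (m + 1) i)
        (Equiv.swap m (m + 1) j - Equiv.swap m (m + 1) i - 1) := by
  have hs := H.sq m hm
  obtain ⟨d, rfl⟩ : ∃ d, j = i + d + 1 := ⟨j - i - 1, by omega⟩
  rw [show i + d + 1 - i - 1 = d by omega]
  by_cases c1 : i = m + 1
  · subst c1
    rw [Equiv.swap_apply_right, Equiv.swap_apply_of_ne_of_ne (by omega) (by omega),
      show m + 1 + d + 1 - m - 1 = d + 1 by omega]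
    exact conj_conjChain_left H hb m d (by omega)
  by_cases c2 : i = m
  · subst c2
    obtain ⟨e, rfl⟩ : ∃ e, d = e + 1 := ⟨d - 1, by omega⟩
    rw [Equiv.swap_apply_left, Equiv.swap_apply_of_ne_of_ne (by omega) (by omega),
      show i + (e + 1) + 1 - (i + 1) - 1 = e by omega,
      ← conj_conjChain_left H hb i e (by omega), conj_conj_of_sq hs]
  rw [Equiv.swap_apply_of_ne_of_ne c2 c1]
  by_cases c3 : i + d + 1 = m
  · subst c3
    rw [Equiv.swap_apply_left, show i + d + 1 + 1 - i - 1 = d + 1 by omega, conjChain]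
  by_cases c4 : i + d + 1 = m + 1
  · obtain ⟨e, rfl⟩ : ∃ e, d = e + 1 := ⟨d - 1, by omega⟩
    obtain rfl : m = i + e + 1 := by omega
    rw [c4, Equiv.swap_apply_right, show i + e + 1 - i - 1 = e by omega, conjChain,
      conj_conj_of_sq hs]
  rw [Equiv.swap_apply_of_ne_of_ne c3 c4, show i + d + 1 - i - 1 = d by omega,
    conj_eq_iff_of_sq hs]
  by_cases c5 : i < m ∧ m < i + d
  · exact conjChain_comm_inside H hb i m c5.1 d (by omega) c5.2
  · exact conjChain_comm_outside H hb i m hm d (by omega) (by omega)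

/-- Conjugation by `r m` acts on the elements attached to pairs by swapping indices. -/
theorem conj_spreadChain (H : IsCoxeterA N r) (hb : IsAdjacentFamily N r b) (k l m : ℕ)
    (hkl : k ≠ l) (hk : k ≤ N) (hl : l ≤ N) (hm : m < N) :
    r m * spreadChain r b k l * r m =
      spreadChain r b (Equiv.swap m (m + 1) k) (Equiv.swap m (m + 1) l) := by
  have hs := H.sq m hm
  -- The elements `x_{i+1,i}` also form an adjacent family, so descending pairs are covered by the
  -- same lemma.
  have hb' : IsAdjacentFamily N r (fun i => r i * b i * r i) :=
    H.adjacentFamily_mul (H.adjacentFamily_mul H.adjacentFamily_self hb) H.adjacentFamily_self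
  by_cases c1 : k = m ∧ l = m + 1
  · obtain ⟨rfl, rfl⟩ := c1
    simp [spreadChain, conjChain]
  by_cases c2 : l = m ∧ k = m + 1
  · obtain ⟨rfl, rfl⟩ := c2
    simp [spreadChain, conjChain, conj_conj_of_sq hs]
  -- Apart from the two pairs just treated, an adjacent transposition preserves the order of the
  -- indices, so both sides fall in the same branch of the definition.
  have ord : k < l ↔ Equiv.swap m (m + 1) k < Equiv.swap m (m + 1) l := by
    simp only [Equiv.swap_apply_def]
    grind
  unfold spreadChain
  by_cases h : k < l
  · rw [if_pos h, if_pos (ord.1 h)]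
    exact conj_conjChain_swap H hb k l m h hl hm (by omega)
  · rw [if_neg h, if_neg (fun h' => h (ord.2 h'))]
    exact conj_conjChain_swap H hb' l k m (by omega) hk hm (by omega)

/-! ### The Coxeter presentation of the symmetric group -/

/-- The descending product `r (m - 1) * ⋯ * r k`. -/
def _root_.descProd {M : Type*} [Monoid M] (r : ℕ → M) (k : ℕ) : ℕ → M
  | 0 => 1
  | m + 1 => if k ≤ m then r m * descProd r k m else 1

theorem _root_.descProd_of_le {M : Type*} [Monoid M] (r : ℕ → M) {k m : ℕ} (h : m ≤ k) :
    descProd r k m = 1 := by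
  cases m with
  | zero => rfl
  | succ m => rw [descProd, if_neg (by omega)]

theorem _root_.descProd_succ {M : Type*} [Monoid M] (r : ℕ → M) {k m : ℕ} (h : k ≤ m) :
    descProd r k (m + 1) = r m * descProd r k m := by
  rw [descProd, if_pos h]

theorem _root_.descProd_mul_lower {M : Type*} [Monoid M] (r : ℕ → M) (k : ℕ) :
    ∀ m, k + 1 ≤ m → descProd r k m = descProd r (k + 1) m * r k
  | 0, h => by omega
  | m + 1, h => by
    rcases Nat.lt_or_ge k m with h' | h'
    · rw [descProd_succ r (by omega), descProd_succ r (by omega),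
        descProd_mul_lower r k m (by omega), mul_assoc]
    · obtain rfl : k = m := by omega
      rw [descProd_succ r le_rfl, descProd_of_le r le_rfl, descProd_of_le r le_rfl, mul_one,
        one_mul]

theorem descProd_mul_far (H : IsCoxeterA N r) (k j : ℕ) (hj : j + 1 < k) :
    ∀ m, m ≤ N → descProd r k m * r j = r j * descProd r k m
  | 0, _ => by simp [descProd]
  | m + 1, hm => by
    rcases Nat.lt_or_ge m k with h' | h'
    · rw [descProd_of_le r (by omega), one_mul, mul_one]
    · rw [descProd_succ r h', mul_assoc, descProd_mul_far H k j hj m (by omega), ← mul_assoc,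
        ← mul_assoc, H.far j m (by omega) (by omega)]

theorem descProd_mul_above (H : IsCoxeterA N r) (k j : ℕ) (hj : j < N) :
    ∀ m, m + 1 ≤ j → descProd r k m * r j = r j * descProd r k m
  | 0, _ => by simp [descProd]
  | m + 1, hm => by
    rcases Nat.lt_or_ge m k with h' | h'
    · rw [descProd_of_le r (by omega), one_mul, mul_one]
    · rw [descProd_succ r h', mul_assoc, descProd_mul_above H k j hj m (by omega), ← mul_assoc,
        ← mul_assoc, H.far m j (by omega) (by omega)]

/-- Moving `r (j + 1)` leftwards, it meets `r (j + 1) * r j`, where the braid relation lowers its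
index by one; all the other factors commute past. -/
theorem descProd_mul_inside (H : IsCoxeterA N r) (k j : ℕ) (hj : k ≤ j) :
    ∀ m, m ≤ N → j + 1 < m → descProd r k m * r (j + 1) = r j * descProd r k m
  | 0, _, h => by omega
  | m + 1, hm, h => by
    rw [descProd_succ r (show k ≤ m by omega)]
    rcases Nat.lt_or_ge (j + 1) m with h' | h'
    · rw [mul_assoc, descProd_mul_inside H k j hj m (by omega) h', ← mul_assoc,
        ← mul_assoc, H.far j m (by omega) (by omega)]
    · obtain rfl : m = j + 1 := by omega
      rw [descProd_succ r hj]
      have hc := descProd_mul_above H k (j + 1) (by omega) j (by omega)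
      calc r (j + 1) * (r j * descProd r k j) * r (j + 1)
          = r (j + 1) * r j * (descProd r k j * r (j + 1)) := by simp only [mul_assoc]
        _ = (r (j + 1) * r j * r (j + 1)) * descProd r k j := by rw [hc]; simp only [mul_assoc]
        _ = _ := by rw [← H.braid j (by omega)]; simp only [mul_assoc]

/-- The submonoid generated by `r 0, …, r (m - 1)`. -/
def _root_.initialSubmonoid {M : Type*} [Monoid M] (r : ℕ → M) (m : ℕ) : Submonoid M :=
  Submonoid.closure (r '' Set.Iio m)

theorem _root_.mem_initialSubmonoid {M : Type*} [Monoid M] (r : ℕ → M) {i m : ℕ} (h : i < m) :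
    r i ∈ initialSubmonoid r m :=
  Submonoid.subset_closure ⟨i, h, rfl⟩

/-- This is the decomposition into cosets of the smaller symmetric group: the products `descProd r k
(m + 1)` are coset representatives, and right multiplication by a generator either changes `k` by
one or passes to the left as a generator of smaller index. -/
theorem exists_eq_mul_descProd (H : IsCoxeterA N r) {m : ℕ} (hm : m + 1 ≤ N) {x : M}
    (hx : x ∈ initialSubmonoid r (m + 1)) :
    ∃ w ∈ initialSubmonoid r m, ∃ k ≤ m + 1, x = w * descProd r k (m + 1) := by
  induction hx using Submonoid.closure_induction_right with
  | one => exact ⟨1, one_mem _, m + 1, le_rfl, by rw [descProd_of_le r le_rfl, mul_one]⟩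
  | mul_right x _ y hy ih =>
    obtain ⟨j, hj, rfl⟩ := hy
    obtain ⟨w, hw, k, hk, rfl⟩ := ih
    have hj : j < m + 1 := hj
    rcases lt_trichotomy j k with h | rfl | h
    · rcases Nat.lt_or_ge (j + 1) k with h' | h'
      · refine ⟨w * r j, mul_mem hw (mem_initialSubmonoid r (by omega)), k, hk, ?_⟩
        rw [mul_assoc, descProd_mul_far H k j h' (m + 1) hm, mul_assoc]
      · obtain rfl : k = j + 1 := by omega
        exact ⟨w, hw, j, by omega, by rw [mul_assoc, ← descProd_mul_lower r j (m + 1) hk]⟩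
    · refine ⟨w, hw, j + 1, by omega, ?_⟩
      rw [descProd_mul_lower r j (m + 1) (by omega), mul_assoc, mul_assoc, H.sq j (by omega),
        mul_one]
    · obtain ⟨i, rfl⟩ : ∃ i, j = i + 1 := ⟨j - 1, by omega⟩
      refine ⟨w * r i, mul_mem hw (mem_initialSubmonoid r (by omega)), k, hk, ?_⟩
      rw [mul_assoc, descProd_mul_inside H k i (by omega) (m + 1) hm (by omega), mul_assoc]

/-- The Coxeter relations present the symmetric group: a product of the `r i` whose permutation is
trivial is itself trivial. -/
theorem eq_one_of_perm_eq_one (H : IsCoxeterA N r) (π : M →* Equiv.Perm ℕ)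
    (hπ : ∀ i < N, ∀ j ≤ N, π (r i) j = Equiv.swap i (i + 1) j) :
    ∀ m ≤ N, ∀ x ∈ initialSubmonoid r m, π x = 1 → x = 1
  | 0, _, x, hx, _ => by
    simpa [initialSubmonoid] using hx
  | m + 1, hm, x, hx, h1 => by
    obtain ⟨w, hw, k, hk, rfl⟩ := H.exists_eq_mul_descProd hm hx
    -- The descending product carries `k` up to the top strand `p`, one step per factor. As `w`
    -- fixes the top strand `m + 1`, a trivial permutation forces `k = m + 1`, so the product is
    -- empty and the induction continues with `w`.
    have hD : ∀ p, k ≤ p → p ≤ N → π (descProd r k p) k = p := by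
      intro p hp hpN
      induction p, hp using Nat.le_induction with
      | base => rw [descProd_of_le r le_rfl, map_one, Equiv.Perm.one_apply]
      | succ p hp ih =>
        rw [descProd_succ r hp, map_mul, Equiv.Perm.mul_apply, ih (by omega),
          hπ p (by omega) p (by omega), Equiv.swap_apply_left]
    have hW : π w (m + 1) = m + 1 := by
      clear h1 hx
      induction hw using Submonoid.closure_induction with
      | mem y hy =>
        obtain ⟨j, hj, rfl⟩ := hy
        have hj : j < m := hj
        rw [hπ j (by omega) _ hm, Equiv.swap_apply_of_ne_of_ne (by omega) (by omega)]
      | one => simp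
      | mul y z _ _ hy hz => rw [map_mul, Equiv.Perm.mul_apply, hz, hy]
    have e : k = m + 1 := by
      have := DFunLike.congr_fun h1 k
      rw [map_mul, Equiv.Perm.mul_apply, hD _ hk hm, hW] at this
      simpa using this.symm
    rw [e, descProd_of_le r le_rfl, mul_one] at h1 ⊢
    exact H.eq_one_of_perm_eq_one π hπ m (by omega) w hw h1

end IsCoxeterA

/-! ### Moving involutions and inverses through relations -/

section Monoid

variable {M : Type*} [Monoid M]

theorem mul_right_cancel_of_mul_eq_one {p q x y : M} (h : p * q = 1) :
    x * p = y * p ↔ x = y := by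
  refine ⟨fun e => ?_, fun e => by rw [e]⟩
  simpa only [mul_assoc, h, mul_one] using congrArg (· * q) e

/-- Passing two commuting involutions through a commutation relation. -/
theorem mul_comm_iff_of_involutions {p q a b : M} (hp : p * p = 1) (hq : q * q = 1)
    (hpq : p * q = q * p) (hb : p * b = b * p) (ha : q * a = a * q) :
    (a * p) * (b * q) = (b * q) * (a * p) ↔ a * b = b * a := by
  have h1 : (a * p) * (b * q) = (a * b) * (p * q) := by
    rw [show (a * p) * (b * q) = a * (p * b) * q by simp only [mul_assoc], hb]
    simp only [mul_assoc]
  have h2 : (b * q) * (a * p) = (b * a) * (p * q) := by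
    rw [show (b * q) * (a * p) = b * (q * a) * p by simp only [mul_assoc], ha, hpq]
    simp only [mul_assoc]
  rw [h1, h2]
  refine mul_right_cancel_of_mul_eq_one (q := q * p) ?_
  rw [show p * q * (q * p) = p * (q * q) * p by simp only [mul_assoc], hq, mul_one, hp]

/-- Passing the two sides of a braid relation between involutions through a relation of length
three. -/
theorem mul_mul_iff_of_involutions {p q a b b' c c' c'' d e e' f f' f'' : M} (hp : p * p = 1)
    (hq : q * q = 1) (hpq : p * q * p = q * p * q) (hb : p * b = b' * p) (hc : q * c = c' * q)
    (hc' : p * c' = c'' * p) (he : q * e = e' * q) (hf : p * f = f' * p)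
    (hf' : q * f' = f'' * q) :
    (a * p) * (b * q) * (c * p) = (d * q) * (e * p) * (f * q) ↔
      a * b' * c'' = d * e' * f'' := by
  have h1 : (a * p) * (b * q) * (c * p) = (a * b' * c'') * (p * q * p) := by
    calc (a * p) * (b * q) * (c * p) = a * (p * b) * (q * c) * p := by simp only [mul_assoc]
      _ = a * b' * (p * c') * q * p := by rw [hb, hc]; simp only [mul_assoc]
      _ = _ := by rw [hc']; simp only [mul_assoc]
  have h2 : (d * q) * (e * p) * (f * q) = (d * e' * f'') * (p * q * p) := by
    calc (d * q) * (e * p) * (f * q) = d * (q * e) * (p * f) * q := by simp only [mul_assoc]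
      _ = d * e' * (q * f') * p * q := by rw [he, hf]; simp only [mul_assoc]
      _ = _ := by rw [hf', hpq]; simp only [mul_assoc]
  rw [h1, h2]
  refine mul_right_cancel_of_mul_eq_one (q := p * q * p) ?_
  calc p * q * p * (p * q * p) = p * q * (p * p) * q * p := by simp only [mul_assoc]
    _ = p * (q * q) * p := by rw [hp, mul_one]; simp only [mul_assoc]
    _ = 1 := by rw [hq, mul_one, hp]

theorem mul_mul_eq_of_involutions {p q a b c : M}
    (hpq : p * q * p = q * p * q) (hb : p * b = c * p) (ha : q * a = c * q) :
    p * (b * q) * p = q * (a * p) * q := by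
  calc p * (b * q) * p = (p * b) * q * p := by simp only [mul_assoc]
    _ = c * (p * q * p) := by rw [hb]; simp only [mul_assoc]
    _ = (c * q) * p * q := by rw [hpq]; simp only [mul_assoc]
    _ = _ := by rw [← ha]; simp only [mul_assoc]

/-- This translates the twist relations: `x * p` stands for a crossing, with `p` the transposition
that exchanges the two bars `g` and `h`. -/
theorem twist_iff_of_involution {p x x' g h : M} (hp : p * p = 1) (hx : p * x = x' * p)
    (hg : p * g = h * p) (hh : p * h = g * p) (hgh : g * h = h * g) :
    p * (x * p) * p = h * g * (x * p) * g * h ↔ x' = g * h * x * h * g := by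
  have h1 : p * (x * p) * p = x' * p := by
    rw [mul_assoc, mul_assoc x, hp, mul_one, hx]
  have h2 : h * g * (x * p) * g * h = (g * h * x * h * g) * p := by
    calc h * g * (x * p) * g * h = h * g * x * (p * g) * h := by simp only [mul_assoc]
      _ = h * g * x * h * (p * h) := by rw [hg]; simp only [mul_assoc]
      _ = _ := by rw [hh, hgh]; simp only [mul_assoc]
  rw [h1, h2]
  exact mul_right_cancel_of_mul_eq_one hp

theorem mul_comm_same_iff_of_involution {p x x' z z' : M} (hp : p * p = 1) (hx : p * x = x' * p)
    (hz : p * z = z' * p) : (x * p) * (z * p) = (z * p) * (x * p) ↔ x * z' = z * x' := by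
  have key : ∀ {s t t' : M}, p * t = t' * p → (s * p) * (t * p) = s * t' := by
    intro s t t' ht
    rw [show (s * p) * (t * p) = s * (p * t) * p by simp only [mul_assoc], ht, mul_assoc,
      mul_assoc, hp, mul_one]
  rw [key hz, key hx]

theorem commute_of_mul_eq_one {u u' y : M} (h : u * u' = 1) (h' : u' * u = 1)
    (c : u * y = y * u) : u' * y = y * u' := by
  calc u' * y = u' * (y * u) * u' := by simp only [mul_assoc, h, mul_one]
    _ = (u' * u) * y * u' := by rw [← c]; simp only [mul_assoc]
    _ = _ := by rw [h', one_mul]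

theorem mul_mul_of_inverses {u u' v v' y : M} (hu : u' * u = 1)
    (hv : v' * v = 1) (hu' : u * u' = 1) (hv' : v * v' = 1)
    (e : u' * v' * y = y * v' * u') : y * (u * v) = (v * u) * y := by
  calc y * (u * v) = v * (u * u') * v' * y * (u * v) := by rw [hu', mul_one, hv', one_mul]
    _ = (v * u) * (u' * v' * y) * (u * v) := by simp only [mul_assoc]
    _ = (v * u) * y * v' * (u' * u) * v := by rw [e]; simp only [mul_assoc]
    _ = _ := by rw [hu, mul_one, mul_assoc, hv, mul_one]

/-- The crossings `σ i` produce relations in λ⁻¹, while the presentation is stated in λ; this passes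
between the two without needing `y` to be invertible. -/
theorem mul_mul_inverses_iff {u u' v v' y : M} (hu : u' * u = 1)
    (hv : v' * v = 1) (hu' : u * u' = 1) (hv' : v * v' = 1) :
    u' * v' * y = y * v' * u' ↔ y * (u * v) = (v * u) * y := by
  refine ⟨mul_mul_of_inverses hu hv hu' hv', fun e => ?_⟩
  have := mul_mul_of_inverses hv' hu' hv hu (y := y) (by rw [← e, mul_assoc])
  rw [← this, mul_assoc]

theorem mul_inverse_iff {u u' v v' y z : M} (hu : u' * u = 1)
    (hv : v' * v = 1) (hu' : u * u' = 1) (hv' : v * v' = 1) :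
    u' * y = z * v' ↔ y * v = u * z := by
  constructor <;> intro e
  · calc y * v = (u * u') * y * v := by rw [hu', one_mul]
      _ = u * (u' * y) * v := by simp only [mul_assoc]
      _ = _ := by rw [e]; simp only [mul_assoc, hv, mul_one]
  · calc u' * y = u' * (y * v) * v' := by simp only [mul_assoc, hv', mul_one]
      _ = (u' * u) * z * v' := by rw [e]; simp only [mul_assoc]
      _ = _ := by rw [hu, one_mul]

theorem eq_of_mul_eq_one {u u' v v' : M} (hu : u' * u = 1) (hv : v * v' = 1) (e : u = v) :
    u' = v' := by
  subst e
  exact left_inv_eq_right_inv hu hv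

end Monoid

/-! ### Renumbering the strands in the presented monoid -/

namespace STVP

variable {n : ℕ}

/-- Renumbering the strands in a letter. -/
def Gen.relabel (g : Equiv.Perm (Fin n)) : Gen n → Gen n
  | .lam k l h => .lam (g k) (g l) (g.injective.ne h)
  | .lamInv k l h => .lamInv (g k) (g l) (g.injective.ne h)
  | .y k l h => .y (g k) (g l) (g.injective.ne h)
  | .gamma j => .gamma (g j)

theorem Gen.relabel_one (x : Gen n) : x.relabel 1 = x := by cases x <;> rfl

theorem Gen.relabel_mul (g h : Equiv.Perm (Fin n)) (x : Gen n) :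
    x.relabel (g * h) = (x.relabel h).relabel g := by cases x <;> rfl

theorem Rel.relabel (g : Equiv.Perm (Fin n)) {u v : FreeMonoid (Gen n)} (h : Rel n u v) :
    Rel n (FreeMonoid.map (Gen.relabel g) u) (FreeMonoid.map (Gen.relabel g) v) := by
  have inj : ∀ {a b : Fin n}, a ≠ b → g a ≠ g b := fun h => g.injective.ne h
  cases h with
  | gamma_sq i => exact .gamma_sq _
  | gamma_comm i j => exact .gamma_comm _ _
  | lam_mul_inv i j ij => exact .lam_mul_inv _ _ _
  | lam_inv_mul i j ij => exact .lam_inv_mul _ _ _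
  | lam_lam i j k l ij kl ik il jk jl =>
    exact .lam_lam _ _ _ _ _ _ (inj ik) (inj il) (inj jk) (inj jl)
  | lam_lam_lam i j k ij ki kj => exact .lam_lam_lam _ _ _ _ _ _
  | lam_gamma i j k ij ki kj => exact .lam_gamma _ _ _ _ (inj ki) (inj kj)
  | lam_twist i j ij => exact .lam_twist _ _ (inj ij)
  | y_y i j k l ij kl ik il jk jl => exact .y_y _ _ _ _ _ _ (inj ik) (inj il) (inj jk) (inj jl)
  | lam_y i j k l ij kl ik il jk jl =>
    exact .lam_y _ _ _ _ _ _ (inj ik) (inj il) (inj jk) (inj jl)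
  | lam_lam_y i j k ij ki kj => exact .lam_lam_y _ _ _ _ _ _
  | y_lam k l kl => exact .y_lam _ _ (inj kl)
  | y_lam_lam i j k ij ki kj => exact .y_lam_lam _ _ _ _ _ _
  | y_gamma i j k ij ki kj => exact .y_gamma _ _ _ _ (inj ki) (inj kj)
  | y_twist i j ij => exact .y_twist _ _ (inj ij)

/-- The symmetric group acts on the presented monoid by renumbering the strands. -/
def relabelHom (g : Equiv.Perm (Fin n)) : PresentedMonoid (Rel n) →* PresentedMonoid (Rel n) :=
  PresentedMonoid.lift (fun x => PresentedMonoid.of (Rel n) (x.relabel g)) fun u v h => by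
    have e : FreeMonoid.lift (fun x => PresentedMonoid.of (Rel n) (Gen.relabel g x)) =
        (PresentedMonoid.mk (Rel n)).comp (FreeMonoid.map (Gen.relabel g)) :=
      FreeMonoid.hom_eq fun x => rfl
    rw [e]
    exact PresentedMonoid.mk_eq_mk_of_rel (h.relabel g)

theorem relabelHom_of (g : Equiv.Perm (Fin n)) (x : Gen n) :
    relabelHom g (PresentedMonoid.of (Rel n) x) = PresentedMonoid.of (Rel n) (x.relabel g) := rfl

instance : MulDistribMulAction (Equiv.Perm (Fin n)) (PresentedMonoid (Rel n)) where
  smul g a := relabelHom g a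
  one_smul a := DFunLike.congr_fun (show relabelHom 1 = MonoidHom.id _ from
    PresentedMonoid.ext _ fun x => by rw [relabelHom_of, x.relabel_one]; rfl) a
  mul_smul g h a := DFunLike.congr_fun (show relabelHom (g * h) = (relabelHom g).comp (relabelHom h)
    from PresentedMonoid.ext _ fun x => by
      rw [relabelHom_of, x.relabel_mul]; rfl) a
  smul_mul g a b := map_mul (relabelHom g) a b
  smul_one g := map_one (relabelHom g)

end STVP

/-! ### Adjacent transpositions evaluated on strands -/

namespace STVB

variable {n : ℕ}

theorem fst_ne_snd (i : Fin (n - 1)) : fst i ≠ snd i := by simp [fst, snd, Fin.ext_iff]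

/-- The transposition of the strands `i` and `i + 1`. -/
abbrev adjSwap (i : Fin (n - 1)) : Equiv.Perm (Fin n) := Equiv.swap (fst i) (snd i)

theorem Far.symm {i j : Fin (n - 1)} (h : Far i j) : Far j i := by
  unfold Far at *
  rwa [abs_sub_comm]

theorem Far.ne {i j : Fin (n - 1)} (h : Far i j) :
    fst i ≠ fst j ∧ fst i ≠ snd j ∧ snd i ≠ fst j ∧ snd i ≠ snd j := by
  unfold Far at h
  rw [lt_abs] at h
  simp only [fst, snd, ne_eq, Fin.ext_iff]
  omega

theorem Far.swap_fst {i j : Fin (n - 1)} (h : Far i j) : adjSwap i (fst j) = fst j :=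
  Equiv.swap_apply_of_ne_of_ne h.ne.1.symm h.ne.2.2.1.symm

theorem Far.swap_snd {i j : Fin (n - 1)} (h : Far i j) : adjSwap i (snd j) = snd j :=
  Equiv.swap_apply_of_ne_of_ne h.ne.2.1.symm h.ne.2.2.2.symm

theorem swap_fst_fst (i : Fin (n - 1)) : adjSwap i (fst i) = snd i := Equiv.swap_apply_left _ _

theorem swap_snd_snd (i : Fin (n - 1)) : adjSwap i (snd i) = fst i := Equiv.swap_apply_right _ _

theorem fst_eq_snd_of_succ {i j : Fin (n - 1)} (h : (j : ℕ) = i + 1) :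
    fst j = snd i := by simp [fst, snd, h]

theorem fst_ne_snd_of_succ {i j : Fin (n - 1)} (h : (j : ℕ) = i + 1) : fst i ≠ snd j := by
  simp only [fst, snd, ne_eq, Fin.ext_iff]
  omega

theorem snd_ne_snd_of_succ {i j : Fin (n - 1)} (h : (j : ℕ) = i + 1) : snd i ≠ snd j := by
  simp only [snd, ne_eq, Fin.ext_iff]
  omega

theorem swap_snd_of_succ {i j : Fin (n - 1)} (h : (j : ℕ) = i + 1) : adjSwap i (snd j) = snd j :=
  Equiv.swap_apply_of_ne_of_ne (fst_ne_snd_of_succ h).symm (snd_ne_snd_of_succ h).symm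

theorem swap_fst_of_succ {i j : Fin (n - 1)} (h : (j : ℕ) = i + 1) : adjSwap j (fst i) = fst i := by
  refine Equiv.swap_apply_of_ne_of_ne ?_ (fst_ne_snd_of_succ h)
  rw [fst_eq_snd_of_succ h]
  exact fst_ne_snd i

theorem swap_mid_of_succ {i j : Fin (n - 1)} (h : (j : ℕ) = i + 1) : adjSwap j (snd i) = snd j := by
  rw [← fst_eq_snd_of_succ h]
  exact swap_fst_fst j

theorem swap_snd_mid_of_succ {i j : Fin (n - 1)} (h : (j : ℕ) = i + 1) : adjSwap j (snd j) = snd i := by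
  rw [← fst_eq_snd_of_succ h]
  exact swap_snd_snd j

end STVB

/-! ### The action of the braid monoid on the presented monoid -/

namespace STVP

open STVB (fst snd Far adjSwap fst_ne_snd)

variable {n : ℕ}

/-- The letters, as elements of the presented monoid. -/
abbrev L (k l : Fin n) (h : k ≠ l) : PresentedMonoid (Rel n) :=
  PresentedMonoid.of (Rel n) (.lam k l h)
abbrev Li (k l : Fin n) (h : k ≠ l) : PresentedMonoid (Rel n) :=
  PresentedMonoid.of (Rel n) (.lamInv k l h)
abbrev Y (k l : Fin n) (h : k ≠ l) : PresentedMonoid (Rel n) :=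
  PresentedMonoid.of (Rel n) (.y k l h)
abbrev G (j : Fin n) : PresentedMonoid (Rel n) := PresentedMonoid.of (Rel n) (.gamma j)

theorem mk_eq {u v : FreeMonoid (Gen n)} (h : Rel n u v) :
    PresentedMonoid.mk (Rel n) u = PresentedMonoid.mk (Rel n) v :=
  PresentedMonoid.mk_eq_mk_of_rel h

theorem L_mul_Li (k l : Fin n) (h : k ≠ l) : L k l h * Li k l h = 1 := mk_eq (.lam_mul_inv k l h)

theorem Li_mul_L (k l : Fin n) (h : k ≠ l) : Li k l h * L k l h = 1 := mk_eq (.lam_inv_mul k l h)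

theorem G_comm (i j : Fin n) : G i * G j = G j * G i := mk_eq (.gamma_comm i j)

theorem G_sq (i : Fin n) : G i * G i = 1 := mk_eq (.gamma_sq i)

theorem Li_comm_Li {i j k l : Fin n} (ij : i ≠ j) (kl : k ≠ l)
    (ik : i ≠ k) (il : i ≠ l) (jk : j ≠ k) (jl : j ≠ l) :
    Li i j ij * Li k l kl = Li k l kl * Li i j ij := by
  refine commute_of_mul_eq_one (L_mul_Li i j ij) (Li_mul_L i j ij) ?_
  refine (commute_of_mul_eq_one (L_mul_Li k l kl) (Li_mul_L k l kl) ?_).symm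
  exact mk_eq (.lam_lam k l i j kl ij ik.symm jk.symm il.symm jl.symm)

theorem Li_comm_Y {i j k l : Fin n} (ij : i ≠ j) (kl : k ≠ l)
    (ik : i ≠ k) (il : i ≠ l) (jk : j ≠ k) (jl : j ≠ l) :
    Li i j ij * Y k l kl = Y k l kl * Li i j ij :=
  commute_of_mul_eq_one (L_mul_Li i j ij) (Li_mul_L i j ij)
    (mk_eq (.lam_y i j k l ij kl ik il jk jl))

theorem Li_comm_G {i j k : Fin n} (ij : i ≠ j) (ki : k ≠ i) (kj : k ≠ j) :
    Li i j ij * G k = G k * Li i j ij :=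
  commute_of_mul_eq_one (L_mul_Li i j ij) (Li_mul_L i j ij) (mk_eq (.lam_gamma i j k ij ki kj))

theorem Li_Li_Li {i j k : Fin n} (ij : i ≠ j) (ki : k ≠ i) (kj : k ≠ j) :
    Li k i ki * Li k j kj * Li i j ij = Li i j ij * Li k j kj * Li k i ki := by
  refine (mul_mul_inverses_iff (Li_mul_L k i ki) (Li_mul_L k j kj) (L_mul_Li k i ki)
    (L_mul_Li k j kj)).2 ?_
  refine (mul_inverse_iff (Li_mul_L i j ij) (Li_mul_L i j ij) (L_mul_Li i j ij)
    (L_mul_Li i j ij)).2 ?_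
  rw [mul_assoc, ← mul_assoc (L i j ij)]
  exact mk_eq (.lam_lam_lam i j k ij ki kj)

theorem Li_Li_Y {i j k : Fin n} (ij : i ≠ j) (ki : k ≠ i) (kj : k ≠ j) :
    Li k j kj * Li k i ki * Y i j ij = Y i j ij * Li k i ki * Li k j kj := by
  refine (mul_mul_inverses_iff (Li_mul_L k j kj) (Li_mul_L k i ki) (L_mul_Li k j kj)
    (L_mul_Li k i ki)).2 ?_
  rw [← mul_assoc, mul_assoc (L k i ki)]
  exact (mk_eq (.lam_lam_y i j k ij ki kj)).symm

theorem Li_Li_Y' {i j k : Fin n} (ij : i ≠ j) (ki : k ≠ i) (kj : k ≠ j) :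
    Li k j kj * Li i j ij * Y k i ki = Y k i ki * Li i j ij * Li k j kj := by
  refine (mul_mul_inverses_iff (Li_mul_L k j kj) (Li_mul_L i j ij) (L_mul_Li k j kj)
    (L_mul_Li i j ij)).2 ?_
  exact mk_eq (.y_lam_lam i j k ij ki kj)

theorem Li_mul_Y {k l : Fin n} (kl : k ≠ l) :
    Li k l kl * Y k l kl = Y l k kl.symm * Li l k kl.symm :=
  (mul_inverse_iff (Li_mul_L k l kl) (Li_mul_L l k kl.symm) (L_mul_Li k l kl)
    (L_mul_Li l k kl.symm)).2 (mk_eq (.y_lam k l kl))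

theorem G_mul_cancel (i : Fin n) (x : PresentedMonoid (Rel n)) : G i * (G i * x) = x := by
  rw [← mul_assoc, G_sq, one_mul]

theorem Li_twist {i j : Fin n} (ij : i ≠ j) :
    Li i j ij = G i * G j * Li j i ij.symm * G j * G i := by
  refine eq_of_mul_eq_one (Li_mul_L i j ij) (v := G i * G j * L j i ij.symm * G j * G i) ?_
    (mk_eq (.lam_twist i j ij))
  have := L_mul_Li j i ij.symm
  simp only [mul_assoc, G_mul_cancel]
  rw [← mul_assoc (L j i ij.symm), this, one_mul, G_mul_cancel, G_sq]

theorem Y_twist {i j : Fin n} (ij : i ≠ j) :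
    Y i j ij = G i * G j * Y j i ij.symm * G j * G i := mk_eq (.y_twist i j ij)

/-- Left multiplications, as self-maps of the presented monoid. -/
abbrev opL : PresentedMonoid (Rel n) →* Function.End (PresentedMonoid (Rel n)) :=
  MulAction.toEndHom

/-- Renumberings, as self-maps of the presented monoid. -/
abbrev opP : Equiv.Perm (Fin n) →* Function.End (PresentedMonoid (Rel n)) :=
  MulAction.toEndHom

/-- This is the multiplication law of the semidirect product, realised by self-maps. -/
theorem opP_mul_opL {g : Equiv.Perm (Fin n)} {a a' : PresentedMonoid (Rel n)} (h : g • a = a') :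
    opP g * opL a = opL a' * opP g := by
  subst h
  funext x
  exact smul_mul' g a x

/-- The new indices are variables tied by equations, so that no rewriting is needed under the proof
of their distinctness. -/
theorem opP_mul_Li {g : Equiv.Perm (Fin n)} {k l k' l' : Fin n} {h : k ≠ l} (h' : k' ≠ l')
    (hk : g k = k') (hl : g l = l') :
    opP g * opL (Li k l h) = opL (Li k' l' h') * opP g := by
  subst hk hl
  exact opP_mul_opL rfl

theorem opP_mul_Y {g : Equiv.Perm (Fin n)} {k l k' l' : Fin n} {h : k ≠ l} (h' : k' ≠ l')
    (hk : g k = k') (hl : g l = l') :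
    opP g * opL (Y k l h) = opL (Y k' l' h') * opP g := by
  subst hk hl
  exact opP_mul_opL rfl

theorem opP_mul_G {g : Equiv.Perm (Fin n)} {k k' : Fin n} (hk : g k = k') :
    opP g * opL (G k) = opL (G k') * opP g := by
  subst hk
  exact opP_mul_opL rfl

theorem opP_adjSwap_sq (i : Fin (n - 1)) : opP (adjSwap i) * opP (adjSwap i) = 1 := by
  rw [← map_mul, Equiv.swap_mul_self, map_one]

theorem opP_far {i j : Fin (n - 1)} (h : Far i j) :
    opP (adjSwap i) * opP (adjSwap j) = opP (adjSwap j) * opP (adjSwap i) := by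
  rw [← map_mul, ← map_mul, STVB.swap_far i j h]

theorem opP_braid {i j : Fin (n - 1)} (h : (j : ℕ) = i + 1) :
    opP (adjSwap i) * opP (adjSwap j) * opP (adjSwap i) =
      opP (adjSwap j) * opP (adjSwap i) * opP (adjSwap j) := by
  simp only [← map_mul, STVB.swap_braid i j h]

/-- The action of the generators of the singular twisted virtual braid monoid on the presented
monoid: the coset action modulo the symmetric group. -/
def opGen : STVB.Gen n → Function.End (PresentedMonoid (Rel n))
  | .sigma i => opL (Li (fst i) (snd i) (fst_ne_snd i)) * opP (adjSwap i)
  | .sigmaInv i => opP (adjSwap i) * opL (L (fst i) (snd i) (fst_ne_snd i))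
  | .rho i => opP (adjSwap i)
  | .tau i => opL (Y (snd i) (fst i) (fst_ne_snd i).symm) * opP (adjSwap i)
  | .gamma j => opL (G j)

-- In each case the permutations are moved to the right, renumbering the pure letters they cross.
-- The two permutations agree by the relations between transpositions, and the remaining pure words
-- are related in the presentation.
open STVB in
theorem opGen_rel (u v : FreeMonoid (STVB.Gen n)) (h : STVB.Rel n u v) :
    FreeMonoid.lift opGen u = FreeMonoid.lift opGen v := by
  cases h with
  | sigma_far i j h =>
    simp only [map_mul, FreeMonoid.lift_eval_of, opGen]
    refine (mul_comm_iff_of_involutions (opP_adjSwap_sq i) (opP_adjSwap_sq j) (opP_far h)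
      (opP_mul_Li _ h.swap_fst h.swap_snd) (opP_mul_Li _ h.symm.swap_fst h.symm.swap_snd)).2 ?_
    rw [← map_mul, ← map_mul, Li_comm_Li _ _ h.ne.1 h.ne.2.1 h.ne.2.2.1 h.ne.2.2.2]
  | sigma_braid i j h =>
    simp only [map_mul, FreeMonoid.lift_eval_of, opGen, fst_eq_snd_of_succ h]
    refine (mul_mul_iff_of_involutions (opP_adjSwap_sq i) (opP_adjSwap_sq j) (opP_braid h)
      (opP_mul_Li (fst_ne_snd_of_succ h) (swap_snd_snd i) (swap_snd_of_succ h))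
      (opP_mul_Li (fst_ne_snd_of_succ h) (swap_fst_of_succ h) (swap_mid_of_succ h))
      (opP_mul_Li (snd_ne_snd_of_succ h) (swap_fst_fst i) (swap_snd_of_succ h))
      (opP_mul_Li (fst_ne_snd_of_succ h) (swap_fst_of_succ h) (swap_mid_of_succ h))
      (opP_mul_Li (fst_ne_snd_of_succ h) (swap_snd_snd i) (swap_snd_of_succ h))
      (opP_mul_Li (fst_ne_snd i) (swap_fst_of_succ h) (swap_snd_mid_of_succ h))).2 ?_
    simp only [← map_mul]
    rw [Li_Li_Li]
  | rho_sq i => exact opP_adjSwap_sq i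
  | rho_far i j h => exact opP_far h
  | rho_braid i j h => exact opP_braid h
  | sigma_rho_far i j h =>
    simp only [map_mul, FreeMonoid.lift_eval_of, opGen]
    rw [← mul_assoc, opP_mul_Li _ h.symm.swap_fst h.symm.swap_snd, mul_assoc, mul_assoc, opP_far h]
  | rho_sigma_rho i j h =>
    simp only [map_mul, FreeMonoid.lift_eval_of, opGen, fst_eq_snd_of_succ h]
    exact mul_mul_eq_of_involutions (opP_braid h)
      (opP_mul_Li (fst_ne_snd_of_succ h) (swap_snd_snd i) (swap_snd_of_succ h))
      (opP_mul_Li (fst_ne_snd_of_succ h) (swap_fst_of_succ h) (swap_mid_of_succ h))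
  | gamma_sq i =>
    simp only [map_mul, FreeMonoid.lift_eval_of, opGen]
    rw [← map_mul, G_sq, map_one, map_one]
  | gamma_comm i j =>
    simp only [map_mul, FreeMonoid.lift_eval_of, opGen]
    rw [← map_mul, ← map_mul, G_comm]
  | gamma_rho_far i j h h' =>
    simp only [map_mul, FreeMonoid.lift_eval_of, opGen]
    exact (opP_mul_G (Equiv.swap_apply_of_ne_of_ne h h')).symm
  | sigma_gamma_far i j h h' =>
    simp only [map_mul, FreeMonoid.lift_eval_of, opGen]
    rw [mul_assoc, opP_mul_G (Equiv.swap_apply_of_ne_of_ne h h'), ← mul_assoc, ← mul_assoc,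
      ← map_mul, ← map_mul, Li_comm_G _ h h']
  | gamma_rho i =>
    simp only [map_mul, FreeMonoid.lift_eval_of, opGen]
    exact (opP_mul_G (swap_fst_fst i)).symm
  | sigma_twist i =>
    simp only [map_mul, FreeMonoid.lift_eval_of, opGen]
    refine (twist_iff_of_involution (opP_adjSwap_sq i)
      (opP_mul_Li (fst_ne_snd i).symm (swap_fst_fst i) (swap_snd_snd i))
      (opP_mul_G (swap_fst_fst i)) (opP_mul_G (swap_snd_snd i)) ?_).2 ?_
    · rw [← map_mul, ← map_mul, G_comm]
    · simp only [← map_mul]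
      rw [Li_twist, G_comm (snd i) (fst i), mul_assoc _ (G _) (G _), G_comm, ← mul_assoc]
  | sigma_mul_inv i =>
    simp only [map_mul, FreeMonoid.lift_eval_of, opGen, map_one]
    rw [mul_assoc, ← mul_assoc (opP _), opP_adjSwap_sq, one_mul, ← map_mul, Li_mul_L, map_one]
  | sigma_inv_mul i =>
    simp only [map_mul, FreeMonoid.lift_eval_of, opGen, map_one]
    rw [mul_assoc, ← mul_assoc (opL _), ← map_mul, L_mul_Li, map_one, one_mul, opP_adjSwap_sq]
  | tau_far i j h =>
    simp only [map_mul, FreeMonoid.lift_eval_of, opGen]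
    refine (mul_comm_iff_of_involutions (opP_adjSwap_sq i) (opP_adjSwap_sq j) (opP_far h)
      (opP_mul_Y _ h.swap_snd h.swap_fst) (opP_mul_Y _ h.symm.swap_snd h.symm.swap_fst)).2 ?_
    simp only [← map_mul]
    exact congrArg _ (mk_eq (.y_y _ _ _ _ _ _ h.ne.2.2.2 h.ne.2.2.1 h.ne.2.1 h.ne.1))
  | sigma_tau_far i j h =>
    simp only [map_mul, FreeMonoid.lift_eval_of, opGen]
    refine (mul_comm_iff_of_involutions (opP_adjSwap_sq i) (opP_adjSwap_sq j) (opP_far h)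
      (opP_mul_Y _ h.swap_snd h.swap_fst) (opP_mul_Li _ h.symm.swap_fst h.symm.swap_snd)).2 ?_
    rw [← map_mul, ← map_mul, Li_comm_Y _ _ h.ne.2.1 h.ne.1 h.ne.2.2.2 h.ne.2.2.1]
  | sigma_tau i =>
    simp only [map_mul, FreeMonoid.lift_eval_of, opGen]
    refine (mul_comm_same_iff_of_involution (opP_adjSwap_sq i)
      (opP_mul_Li (fst_ne_snd i).symm (swap_fst_fst i) (swap_snd_snd i))
      (opP_mul_Y (fst_ne_snd i) (swap_snd_snd i) (swap_fst_fst i))).2 ?_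
    rw [← map_mul, ← map_mul, Li_mul_Y]
  | sigma_sigma_tau i j h =>
    simp only [map_mul, FreeMonoid.lift_eval_of, opGen, fst_eq_snd_of_succ h]
    refine (mul_mul_iff_of_involutions (opP_adjSwap_sq i) (opP_adjSwap_sq j) (opP_braid h)
      (opP_mul_Li (fst_ne_snd_of_succ h) (swap_snd_snd i) (swap_snd_of_succ h))
      (opP_mul_Y (fst_ne_snd_of_succ h).symm (swap_mid_of_succ h) (swap_fst_of_succ h))
      (opP_mul_Y (snd_ne_snd_of_succ h).symm (swap_snd_of_succ h) (swap_fst_fst i))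
      (opP_mul_Li (fst_ne_snd_of_succ h) (swap_fst_of_succ h) (swap_mid_of_succ h))
      (opP_mul_Li (fst_ne_snd_of_succ h) (swap_snd_snd i) (swap_snd_of_succ h))
      (opP_mul_Li (fst_ne_snd i) (swap_fst_of_succ h) (swap_snd_mid_of_succ h))).2 ?_
    simp only [← map_mul]
    rw [Li_Li_Y]
  | sigma_sigma_tau' i j h =>
    simp only [map_mul, FreeMonoid.lift_eval_of, opGen, fst_eq_snd_of_succ h]
    -- The words start with crossing `j`, so the braid relation is read backwards and `i`, `j`
    -- exchange roles.
    refine (mul_mul_iff_of_involutions (opP_adjSwap_sq j) (opP_adjSwap_sq i) (opP_braid h).symm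
      (opP_mul_Li (fst_ne_snd_of_succ h) (swap_fst_of_succ h) (swap_mid_of_succ h))
      (opP_mul_Y (fst_ne_snd_of_succ h).symm (swap_snd_of_succ h) (swap_snd_snd i))
      (opP_mul_Y (fst_ne_snd i).symm (swap_snd_mid_of_succ h) (swap_fst_of_succ h))
      (opP_mul_Li (fst_ne_snd_of_succ h) (swap_snd_snd i) (swap_snd_of_succ h))
      (opP_mul_Li (fst_ne_snd_of_succ h) (swap_fst_of_succ h) (swap_mid_of_succ h))
      (opP_mul_Li (snd_ne_snd_of_succ h) (swap_fst_fst i) (swap_snd_of_succ h))).2 ?_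
    simp only [← map_mul]
    rw [Li_Li_Y']
  | tau_rho_far i j h =>
    simp only [map_mul, FreeMonoid.lift_eval_of, opGen]
    rw [← mul_assoc, opP_mul_Y _ h.symm.swap_snd h.symm.swap_fst, mul_assoc, mul_assoc, opP_far h]
  | rho_tau_rho i j h =>
    simp only [map_mul, FreeMonoid.lift_eval_of, opGen, fst_eq_snd_of_succ h]
    exact mul_mul_eq_of_involutions (opP_braid h)
      (opP_mul_Y (fst_ne_snd_of_succ h).symm (swap_snd_of_succ h) (swap_snd_snd i))
      (opP_mul_Y (fst_ne_snd_of_succ h).symm (swap_mid_of_succ h) (swap_fst_of_succ h))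
  | tau_gamma_far i j h h' =>
    simp only [map_mul, FreeMonoid.lift_eval_of, opGen]
    rw [mul_assoc, opP_mul_G (Equiv.swap_apply_of_ne_of_ne h h'), ← mul_assoc, ← mul_assoc,
      ← map_mul, ← map_mul]
    exact congrArg (opL · * _) (mk_eq (.y_gamma _ _ _ _ h' h))
  | tau_twist i =>
    simp only [map_mul, FreeMonoid.lift_eval_of, opGen]
    refine (twist_iff_of_involution (opP_adjSwap_sq i)
      (opP_mul_Y (fst_ne_snd i) (swap_snd_snd i) (swap_fst_fst i))
      (opP_mul_G (swap_fst_fst i)) (opP_mul_G (swap_snd_snd i)) ?_).2 ?_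
    · rw [← map_mul, ← map_mul, G_comm]
    · simp only [← map_mul]
      rw [Y_twist]

end STVP

/-! ### Renumbering by conjugation in the braid monoid -/

namespace STVB

variable {n : ℕ}

theorem mk_eq {u v : FreeMonoid (Gen n)} (h : Rel n u v) :
    PresentedMonoid.mk (Rel n) u = PresentedMonoid.mk (Rel n) v :=
  PresentedMonoid.mk_eq_mk_of_rel h

theorem ρ_sq (i : Fin (n - 1)) : ρ i * ρ i = 1 := mk_eq (.rho_sq i)

theorem ρ_far {i j : Fin (n - 1)} (h : Far i j) : ρ i * ρ j = ρ j * ρ i := mk_eq (.rho_far i j h)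

theorem ρ_braid {i j : Fin (n - 1)} (h : (j : ℕ) = i + 1) :
    ρ i * ρ j * ρ i = ρ j * ρ i * ρ j := mk_eq (.rho_braid i j h)

theorem σ_mul_σInv (i : Fin (n - 1)) : σ i * σInv i = 1 := mk_eq (.sigma_mul_inv i)

theorem σInv_mul_σ (i : Fin (n - 1)) : σInv i * σ i = 1 := mk_eq (.sigma_inv_mul i)

/-- A family indexed by the crossings, extended by `1` to all natural numbers. -/
def natExt (a : Fin (n - 1) → STVB n) (i : ℕ) : STVB n := if h : i < n - 1 then a ⟨i, h⟩ else 1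

theorem natExt_of_lt (a : Fin (n - 1) → STVB n) {i : ℕ} (h : i < n - 1) :
    natExt a i = a ⟨i, h⟩ := dif_pos h

theorem natExt_val (a : Fin (n - 1) → STVB n) (i : Fin (n - 1)) : natExt a i = a i :=
  natExt_of_lt a i.2

theorem far_of_lt {i j : ℕ} (hi : i < n - 1) (hj : j < n - 1) (h : i + 1 < j ∨ j + 1 < i) :
    Far (⟨i, hi⟩ : Fin (n - 1)) ⟨j, hj⟩ := by
  simp only [Far, lt_abs]
  omega

theorem isCoxeterA_ρ : IsCoxeterA (n - 1) (natExt (ρ (n := n))) where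
  sq i hi := by
    rw [natExt_of_lt _ hi]
    exact ρ_sq _
  far i j h hj := by
    rw [natExt_of_lt _ hj, natExt_of_lt _ (show i < n - 1 by omega)]
    exact ρ_far (far_of_lt _ _ (Or.inl h))
  braid i hi := by
    rw [natExt_of_lt _ hi, natExt_of_lt _ (show i < n - 1 by omega)]
    exact ρ_braid rfl

theorem isAdjacentFamily_of_rel {a : Fin (n - 1) → STVB n}
    (hf : ∀ i j, Far i j → ρ i * a j = a j * ρ i)
    (hb : ∀ i j : Fin (n - 1), (j : ℕ) = i + 1 → ρ i * a j * ρ i = ρ j * a i * ρ j) :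
    IsAdjacentFamily (n - 1) (natExt (ρ (n := n))) (natExt a) where
  far i j hi hj h := by
    rw [natExt_of_lt _ hi, natExt_of_lt _ hj]
    exact hf _ _ (far_of_lt _ _ h)
  braid i hi := by
    rw [natExt_of_lt _ hi, natExt_of_lt _ (show i < n - 1 by omega), natExt_of_lt _ hi,
      natExt_of_lt _ (show i < n - 1 by omega)]
    exact hb _ _ rfl

theorem natExt_mul (a b : Fin (n - 1) → STVB n) :
    natExt (fun i => a i * b i) = fun i => natExt a i * natExt b i := by
  funext i
  unfold natExt
  split_ifs <;> simp

theorem isAdjacentFamily_σ : IsAdjacentFamily (n - 1) (natExt (ρ (n := n))) (natExt σ) :=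
  isAdjacentFamily_of_rel (fun i j h => (mk_eq (.sigma_rho_far j i h.symm)).symm)
    fun i j h => mk_eq (.rho_sigma_rho i j h)

theorem isAdjacentFamily_τ : IsAdjacentFamily (n - 1) (natExt (ρ (n := n))) (natExt τ) :=
  isAdjacentFamily_of_rel (fun i j h => (mk_eq (.tau_rho_far j i h.symm)).symm)
    fun i j h => mk_eq (.rho_tau_rho i j h)

theorem conj_mul_conj_of_sq {p : STVB n} (hp : p * p = 1) {x x' : STVB n} (h : x * x' = 1) :
    (p * x * p) * (p * x' * p) = 1 := by
  rw [show (p * x * p) * (p * x' * p) = p * x * (p * p) * x' * p by simp only [mul_assoc], hp,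
    mul_one, mul_assoc p, h, mul_one, hp]

/-- No relation involving `ρ` is imposed on `σ i ⁻¹`; these follow from those for `σ i` by
uniqueness of inverses. -/
theorem isAdjacentFamily_σInv : IsAdjacentFamily (n - 1) (natExt (ρ (n := n))) (natExt σInv) :=
  isAdjacentFamily_of_rel
    (fun i j h => (commute_of_mul_eq_one (σ_mul_σInv j) (σInv_mul_σ j)
      (mk_eq (.sigma_rho_far j i h.symm))).symm)
    fun i j h => eq_of_mul_eq_one
      (conj_mul_conj_of_sq (ρ_sq i) (σInv_mul_σ j)) (conj_mul_conj_of_sq (ρ_sq j) (σ_mul_σInv i))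
      (mk_eq (.rho_sigma_rho i j h))

theorem conjρ_eq_conjChain (x : STVB n) (i : ℕ) :
    ∀ (d : ℕ) (h : i + d + 1 < n), conjρ x i d h = conjChain (natExt ρ) x i d
  | 0, _ => rfl
  | d + 1, h => by
    rw [conjρ, conjChain, conjρ_eq_conjChain x i d, natExt_of_lt _ (show i + d + 1 < n - 1 by omega)]

theorem spread_eq_spreadChain (a : Fin (n - 1) → STVB n) (k l : Fin n) (h : k ≠ l) :
    spread a k l h = spreadChain (natExt ρ) (natExt a) k l := by
  have hne : (k : ℕ) ≠ l := fun e => h (Fin.ext e)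
  unfold spread spreadChain
  by_cases c : k < l
  · rw [dif_pos c, if_pos (show (k : ℕ) < l from c), conjρ_eq_conjChain,
      natExt_of_lt a (show (k : ℕ) < n - 1 by omega)]
  · rw [dif_neg c, if_neg (show ¬ (k : ℕ) < l from c), conjρ_eq_conjChain,
      natExt_of_lt a (show (l : ℕ) < n - 1 by omega),
      natExt_of_lt ρ (show (l : ℕ) < n - 1 by omega)]

theorem coe_adjSwap (i : Fin (n - 1)) (k : Fin n) :
    ((adjSwap i k : Fin n) : ℕ) = Equiv.swap (i : ℕ) (i + 1) k := by
  simp only [adjSwap, Equiv.swap_apply_def, fst, snd, Fin.ext_iff]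
  split_ifs <;> rfl

theorem ρ_mul_spread {a : Fin (n - 1) → STVB n}
    (ha : IsAdjacentFamily (n - 1) (natExt (ρ (n := n))) (natExt a)) (i : Fin (n - 1))
    {k l : Fin n} (h : k ≠ l) :
    ρ i * spread a k l h =
      spread a (adjSwap i k) (adjSwap i l) ((adjSwap i).injective.ne h) * ρ i := by
  refine (conj_eq_iff_of_sq (ρ_sq i)).1 ?_
  rw [spread_eq_spreadChain, spread_eq_spreadChain, coe_adjSwap, coe_adjSwap, ← natExt_val ρ i]
  exact isCoxeterA_ρ.conj_spreadChain ha k l i (fun e => h (Fin.ext e)) (by omega) (by omega) i.2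

theorem spread_fst_snd (a : Fin (n - 1) → STVB n) (i : Fin (n - 1)) :
    spread a (fst i) (snd i) (fst_ne_snd i) = a i := by
  rw [spread_eq_spreadChain]
  simp [spreadChain, fst, snd, conjChain, natExt_val]

theorem isAdjacentFamily_lam :
    IsAdjacentFamily (n - 1) (natExt (ρ (n := n))) (natExt fun i => ρ i * σInv i) := by
  rw [natExt_mul]
  exact isCoxeterA_ρ.adjacentFamily_mul isCoxeterA_ρ.adjacentFamily_self isAdjacentFamily_σInv

theorem isAdjacentFamily_lamInv :
    IsAdjacentFamily (n - 1) (natExt (ρ (n := n))) (natExt fun i => σ i * ρ i) := by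
  rw [natExt_mul]
  exact isCoxeterA_ρ.adjacentFamily_mul isAdjacentFamily_σ isCoxeterA_ρ.adjacentFamily_self

theorem isAdjacentFamily_y :
    IsAdjacentFamily (n - 1) (natExt (ρ (n := n))) (natExt fun i => ρ i * τ i) := by
  rw [natExt_mul]
  exact isCoxeterA_ρ.adjacentFamily_mul isCoxeterA_ρ.adjacentFamily_self isAdjacentFamily_τ

theorem ρ_mul_γ (i : Fin (n - 1)) (j : Fin n) : ρ i * γ j = γ (adjSwap i j) * ρ i := by
  have h1 : γ (snd i) * ρ i = ρ i * γ (fst i) := mk_eq (.gamma_rho i)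
  by_cases c : j = fst i
  · rw [c, swap_fst_fst, h1]
  by_cases c' : j = snd i
  · rw [c', swap_snd_snd]
    refine (conj_eq_iff_of_sq (ρ_sq i)).1 ?_
    rw [mul_assoc, h1, ← mul_assoc, ρ_sq, one_mul]
  rw [show adjSwap i j = j from Equiv.swap_apply_of_ne_of_ne c c']
  exact (mk_eq (.gamma_rho_far i j c c')).symm

/-- The elements of the singular twisted virtual braid monoid named by the pure letters. -/
def evalGen : STVP.Gen n → STVB n
  | .lam k l h => lam k l h
  | .lamInv k l h => lamInv k l h
  | .y k l h => y k l h
  | .gamma j => γ j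

theorem ρ_mul_evalGen (i : Fin (n - 1)) (x : STVP.Gen n) :
    ρ i * evalGen x = evalGen (x.relabel (adjSwap i)) * ρ i := by
  cases x with
  | lam k l h => exact ρ_mul_spread isAdjacentFamily_lam i h
  | lamInv k l h => exact ρ_mul_spread isAdjacentFamily_lamInv i h
  | y k l h => exact ρ_mul_spread isAdjacentFamily_y i h
  | gamma j => exact ρ_mul_γ i j

/-- Stated for words, not for elements of the presented monoid, because it is needed to prove that
the pure relations hold. -/
theorem ρ_mul_evalWord (i : Fin (n - 1)) (w : FreeMonoid (STVP.Gen n)) :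
    ρ i * FreeMonoid.lift evalGen w =
      FreeMonoid.lift evalGen (FreeMonoid.map (STVP.Gen.relabel (adjSwap i)) w) * ρ i := by
  induction w with
  | one => simp
  | of x => simpa using ρ_mul_evalGen i x
  | mul u v hu hv => rw [map_mul, map_mul, map_mul, ← mul_assoc, hu, mul_assoc, hv, mul_assoc]

theorem closure_adjSwap :
    Submonoid.closure (Set.range (adjSwap (n := n))) = ⊤ := by
  cases n with
  | zero => exact Subsingleton.elim _ _
  | succ m => exact Equiv.Perm.mclosure_swap_castSucc_succ m

/-- Relations between pure words are preserved when the strands are renumbered. -/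
theorem evalWord_relabel_eq (g : Equiv.Perm (Fin n)) {u v : FreeMonoid (STVP.Gen n)}
    (h : FreeMonoid.lift evalGen u = FreeMonoid.lift evalGen v) :
    FreeMonoid.lift evalGen (FreeMonoid.map (STVP.Gen.relabel g) u) =
      FreeMonoid.lift evalGen (FreeMonoid.map (STVP.Gen.relabel g) v) := by
  have hg : g ∈ Submonoid.closure (Set.range (adjSwap (n := n))) := by
    rw [closure_adjSwap]
    trivial
  induction hg using Submonoid.closure_induction generalizing u v with
  | mem x hx =>
    obtain ⟨i, rfl⟩ := hx
    -- Both evaluated words get a factor `ρ i` on the right, which crosses to the left and undoes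
    -- the renumbering.
    refine (mul_right_cancel_of_mul_eq_one (ρ_sq i)).1 ?_
    rw [← ρ_mul_evalWord, ← ρ_mul_evalWord, h]
  | one =>
    have : STVP.Gen.relabel (1 : Equiv.Perm (Fin n)) = id := funext STVP.Gen.relabel_one
    simpa [this] using h
  | mul x y _ _ hx hy =>
    have e : STVP.Gen.relabel (x * y) = STVP.Gen.relabel x ∘ STVP.Gen.relabel y :=
      funext (STVP.Gen.relabel_mul x y)
    rw [e, FreeMonoid.map_comp]
    exact hx (hy h)

/-- Permutations carry the first strands to any given distinct strands. -/
theorem exists_perm_castLE {m : ℕ} (hm : m ≤ n) (e : Fin m → Fin n)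
    (he : Function.Injective e) :
    ∃ g : Equiv.Perm (Fin n), ∀ t, g (Fin.castLE hm t) = e t := by
  have := Equiv.Perm.isMultiplyPretransitive (Fin n) m
  obtain ⟨g, hg⟩ := MulAction.exists_smul_eq (Equiv.Perm (Fin n)) (Fin.castLEEmb hm)
    (⟨e, he⟩ : Fin m ↪ Fin n)
  exact ⟨g, fun t => DFunLike.congr_fun hg t⟩

end STVB

/-! ### The pure relations hold in the braid monoid -/

namespace STVB

variable {n : ℕ}

theorem exists_perm_pair {i j : Fin n} (ij : i ≠ j) :
    ∃ (a : Fin (n - 1)) (g : Equiv.Perm (Fin n)), g (fst a) = i ∧ g (snd a) = j := by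
  have hn : 2 ≤ n := by
    simpa using Fintype.card_le_of_injective ![i, j] (by
      intro s t; fin_cases s <;> fin_cases t <;> simp [ij, ij.symm])
  obtain ⟨g, hg⟩ := exists_perm_castLE hn ![i, j] (by
    intro s t; fin_cases s <;> fin_cases t <;> simp [ij, ij.symm])
  exact ⟨⟨0, by omega⟩, g, hg 0, hg 1⟩

theorem exists_perm_triple {i j k : Fin n} (ij : i ≠ j) (ik : i ≠ k) (jk : j ≠ k) :
    ∃ (a b : Fin (n - 1)) (g : Equiv.Perm (Fin n)), (b : ℕ) = a + 1 ∧
      g (fst a) = i ∧ g (snd a) = j ∧ g (snd b) = k := by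
  have inj : Function.Injective ![i, j, k] := by
    intro s t; fin_cases s <;> fin_cases t <;> simp [ij, ij.symm, ik, ik.symm, jk, jk.symm]
  have hn : 3 ≤ n := by simpa using Fintype.card_le_of_injective _ inj
  obtain ⟨g, hg⟩ := exists_perm_castLE hn _ inj
  exact ⟨⟨0, by omega⟩, ⟨1, by omega⟩, g, rfl, hg 0, hg 1, hg 2⟩

theorem exists_perm_quadruple {i j k l : Fin n} (ij : i ≠ j) (kl : k ≠ l) (ik : i ≠ k)
    (il : i ≠ l) (jk : j ≠ k) (jl : j ≠ l) :
    ∃ (a b : Fin (n - 1)) (g : Equiv.Perm (Fin n)), Far a b ∧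
      g (fst a) = i ∧ g (snd a) = j ∧ g (fst b) = k ∧ g (snd b) = l := by
  have inj : Function.Injective ![i, j, k, l] := by
    intro s t
    fin_cases s <;> fin_cases t <;>
      simp [ij, ij.symm, ik, ik.symm, jk, jk.symm, kl, kl.symm, il, il.symm, jl, jl.symm]
  have hn : 4 ≤ n := by simpa using Fintype.card_le_of_injective _ inj
  obtain ⟨g, hg⟩ := exists_perm_castLE hn _ inj
  -- Crossings `0` and `2` occupy the four disjoint strands `0, 1, 2, 3`.
  exact ⟨⟨0, by omega⟩, ⟨2, by omega⟩, g, far_of_lt _ _ (by omega), hg 0, hg 1, hg 2, hg 3⟩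

theorem ρ_mul_lamInv {i : Fin (n - 1)} {k l k' l' : Fin n} {h : k ≠ l} (h' : k' ≠ l')
    (hk : adjSwap i k = k') (hl : adjSwap i l = l') :
    ρ i * lamInv k l h = lamInv k' l' h' * ρ i := by
  subst hk hl
  exact ρ_mul_evalGen i (.lamInv k l h)

theorem ρ_mul_y {i : Fin (n - 1)} {k l k' l' : Fin n} {h : k ≠ l} (h' : k' ≠ l')
    (hk : adjSwap i k = k') (hl : adjSwap i l = l') :
    ρ i * y k l h = y k' l' h' * ρ i := by
  subst hk hl
  exact ρ_mul_evalGen i (.y k l h)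

theorem ρ_mul_γ_of_eq {i : Fin (n - 1)} {k k' : Fin n} (hk : adjSwap i k = k') :
    ρ i * γ k = γ k' * ρ i := by
  subst hk
  exact ρ_mul_γ i k

theorem lamInv_mul_ρ (i : Fin (n - 1)) : lamInv (fst i) (snd i) (fst_ne_snd i) * ρ i = σ i := by
  rw [lamInv, spread_fst_snd, mul_assoc, ρ_sq, mul_one]

theorem ρ_mul_lam_fst_snd (i : Fin (n - 1)) :
    ρ i * lam (fst i) (snd i) (fst_ne_snd i) = σInv i := by
  rw [lam, spread_fst_snd, ← mul_assoc, ρ_sq, one_mul]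

theorem y_mul_ρ (i : Fin (n - 1)) : y (snd i) (fst i) (fst_ne_snd i).symm * ρ i = τ i := by
  rw [← ρ_mul_y (h := fst_ne_snd i) _ (swap_fst_fst i) (swap_snd_snd i), y, spread_fst_snd,
    ← mul_assoc, ρ_sq, one_mul]

theorem lam_mul_lamInv {i j : Fin n} (ij : i ≠ j) : lam i j ij * lamInv i j ij = 1 := by
  obtain ⟨a, g, rfl, rfl⟩ := exists_perm_pair ij
  refine evalWord_relabel_eq g
    (u := STVP.wL (fst a) (snd a) (fst_ne_snd a) * STVP.wLi _ _ (fst_ne_snd a)) (v := 1) ?_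
  change lam (fst a) (snd a) (fst_ne_snd a) * lamInv (fst a) (snd a) (fst_ne_snd a) = 1
  rw [lam, lamInv, spread_fst_snd, spread_fst_snd, mul_assoc, ← mul_assoc (σInv a), σInv_mul_σ,
    one_mul, ρ_sq]

theorem lamInv_mul_lam {i j : Fin n} (ij : i ≠ j) : lamInv i j ij * lam i j ij = 1 := by
  obtain ⟨a, g, rfl, rfl⟩ := exists_perm_pair ij
  refine evalWord_relabel_eq g
    (u := STVP.wLi (fst a) (snd a) (fst_ne_snd a) * STVP.wL _ _ (fst_ne_snd a)) (v := 1) ?_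
  change lamInv (fst a) (snd a) (fst_ne_snd a) * lam (fst a) (snd a) (fst_ne_snd a) = 1
  rw [lam, lamInv, spread_fst_snd, spread_fst_snd, mul_assoc, ← mul_assoc (ρ a), ρ_sq,
    one_mul, σ_mul_σInv]

/-- By `evalWord_relabel_eq` each relation needs checking for one choice of indices only. The
strands are ordered so that the letters become those of crossings: λ with the lower strand first, y
with the higher strand first, as in `σ i = λ⁻¹_{i,i+1} ρ i` and `τ i = y_{i+1,i} ρ i`. The
translation used for the action is then read backwards. -/
theorem evalGen_rel (u v : FreeMonoid (STVP.Gen n)) (h : STVP.Rel n u v) :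
    FreeMonoid.lift evalGen u = FreeMonoid.lift evalGen v := by
  cases h with
  | gamma_sq i => exact mk_eq (.gamma_sq i)
  | gamma_comm i j => exact mk_eq (.gamma_comm i j)
  | lam_mul_inv i j ij => exact lam_mul_lamInv ij
  | lam_inv_mul i j ij => exact lamInv_mul_lam ij
  | lam_lam i j k l ij kl ik il jk jl =>
    obtain ⟨a, b, g, hab, rfl, rfl, rfl, rfl⟩ := exists_perm_quadruple ij kl ik il jk jl
    refine evalWord_relabel_eq g (u := STVP.wL _ _ (fst_ne_snd a) * STVP.wL _ _ (fst_ne_snd b))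
      (v := STVP.wL _ _ (fst_ne_snd b) * STVP.wL _ _ (fst_ne_snd a)) ?_
    change lam _ _ (fst_ne_snd a) * lam _ _ (fst_ne_snd b) =
      lam _ _ (fst_ne_snd b) * lam _ _ (fst_ne_snd a)
    refine commute_of_mul_eq_one (lamInv_mul_lam _) (lam_mul_lamInv _) ?_
    refine (commute_of_mul_eq_one (lamInv_mul_lam _) (lam_mul_lamInv _) ?_).symm
    refine ((mul_comm_iff_of_involutions (ρ_sq a) (ρ_sq b) (ρ_far hab)
      (ρ_mul_lamInv _ hab.swap_fst hab.swap_snd)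
      (ρ_mul_lamInv _ hab.symm.swap_fst hab.symm.swap_snd)).1 ?_).symm
    rw [lamInv_mul_ρ, lamInv_mul_ρ]
    exact mk_eq (.sigma_far a b hab)
  | lam_lam_lam i j k ij ki kj =>
    -- With the order `k, i, j` all three letters are ascending, and the relation for the inverses
    -- is the braid relation of the `σ`.
    obtain ⟨a, b, g, hab, rfl, rfl, rfl⟩ := exists_perm_triple ki kj ij
    have h1 := fst_ne_snd a
    have h2 := fst_ne_snd_of_succ hab
    have h3 := snd_ne_snd_of_succ hab
    refine evalWord_relabel_eq g (u := STVP.wL _ _ h1 * (STVP.wL _ _ h2 * STVP.wL _ _ h3))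
      (v := (STVP.wL _ _ h3 * STVP.wL _ _ h2) * STVP.wL _ _ h1) ?_
    change lam _ _ h1 * lam _ _ h2 * lam _ _ h3 = (lam _ _ h3 * lam _ _ h2) * lam _ _ h1
    have key : lamInv _ _ h1 * lamInv _ _ h2 * lamInv _ _ h3 =
        lamInv _ _ h3 * lamInv _ _ h2 * lamInv _ _ h1 := by
      refine (mul_mul_iff_of_involutions (ρ_sq a) (ρ_sq b) (ρ_braid hab)
        (ρ_mul_lamInv (h := h3) h2 (swap_snd_snd a) (swap_snd_of_succ hab))
        (ρ_mul_lamInv (h := h1) h2 (swap_fst_of_succ hab) (swap_mid_of_succ hab))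
        (ρ_mul_lamInv (h := h2) h3 (swap_fst_fst a) (swap_snd_of_succ hab))
        (ρ_mul_lamInv (h := h1) h2 (swap_fst_of_succ hab) (swap_mid_of_succ hab))
        (ρ_mul_lamInv (h := h3) h2 (swap_snd_snd a) (swap_snd_of_succ hab))
        (ρ_mul_lamInv (h := h2) h1 (swap_fst_of_succ hab) (swap_snd_mid_of_succ hab))).1 ?_
      have := lamInv_mul_ρ b
      simp only [fst_eq_snd_of_succ hab] at this
      rw [lamInv_mul_ρ, this]
      exact mk_eq (.sigma_braid a b hab)
    refine (mul_mul_inverses_iff (lam_mul_lamInv h1) (lam_mul_lamInv h2)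
      (lamInv_mul_lam h1) (lamInv_mul_lam h2)).2 ?_
    refine (mul_inverse_iff (lam_mul_lamInv h3) (lam_mul_lamInv h3)
      (lamInv_mul_lam h3) (lamInv_mul_lam h3)).2 ?_
    rw [key, mul_assoc]
  | lam_gamma i j k ij ki kj =>
    obtain ⟨a, b, g, hab, rfl, rfl, rfl⟩ := exists_perm_triple ij ki.symm kj.symm
    have h1 := fst_ne_snd a
    have h2 := (fst_ne_snd_of_succ hab).symm
    have h3 := (snd_ne_snd_of_succ hab).symm
    refine evalWord_relabel_eq g (u := STVP.wL _ _ h1 * STVP.wG (snd b))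
      (v := STVP.wG (snd b) * STVP.wL _ _ h1) ?_
    change lam _ _ h1 * γ (snd b) = γ (snd b) * lam _ _ h1
    refine commute_of_mul_eq_one (lamInv_mul_lam _) (lam_mul_lamInv _) ?_
    refine (mul_right_cancel_of_mul_eq_one (ρ_sq a)).1 ?_
    rw [mul_assoc, mul_assoc, lamInv_mul_ρ, ← ρ_mul_γ_of_eq (Equiv.swap_apply_of_ne_of_ne h2 h3),
      ← mul_assoc, lamInv_mul_ρ]
    exact mk_eq (.sigma_gamma_far a _ h2 h3)
  | lam_twist i j ij =>
    obtain ⟨a, g, rfl, rfl⟩ := exists_perm_pair ij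
    have h1 := fst_ne_snd a
    refine evalWord_relabel_eq g (u := STVP.wL _ _ h1)
      (v := STVP.wG _ * STVP.wG _ * STVP.wL _ _ h1.symm * STVP.wG _ * STVP.wG _) ?_
    change lam _ _ h1 = γ (fst a) * γ (snd a) * lam _ _ h1.symm * γ (snd a) * γ (fst a)
    have comm : γ (fst a) * γ (snd a) = γ (snd a) * γ (fst a) := mk_eq (.gamma_comm _ _)
    have key : lamInv _ _ h1.symm =
        γ (fst a) * γ (snd a) * lamInv _ _ h1 * γ (snd a) * γ (fst a) := by
      refine (twist_iff_of_involution (ρ_sq a)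
        (ρ_mul_lamInv h1.symm (swap_fst_fst a) (swap_snd_snd a))
        (ρ_mul_γ_of_eq (swap_fst_fst a)) (ρ_mul_γ_of_eq (swap_snd_snd a)) comm).1 ?_
      rw [lamInv_mul_ρ]
      exact mk_eq (.sigma_twist a)
    -- The twist is known for λ⁻¹. Since `γ (fst a) * γ (snd a)` is an involution, conjugation by it
    -- preserves inverse pairs, so the right-hand side is a right inverse of λ⁻¹ and equals λ.
    refine left_inv_eq_right_inv (lam_mul_lamInv h1) ?_
    have γ_sq : ∀ i : Fin n, γ i * γ i = 1 := fun i => mk_eq (.gamma_sq i)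
    rw [mul_assoc _ (γ (snd a)) (γ (fst a)), ← comm] at key ⊢
    have tt : (γ (fst a) * γ (snd a)) * (γ (fst a) * γ (snd a)) = 1 := by
      nth_rewrite 2 [comm]
      rw [mul_assoc, ← mul_assoc (γ (snd a)), γ_sq, one_mul, γ_sq]
    rw [← conj_conj_of_sq tt (x := lamInv _ _ h1), ← key]
    exact conj_mul_conj_of_sq tt (lamInv_mul_lam _)
  | y_y i j k l ij kl ik il jk jl =>
    obtain ⟨b, a, g, hab, rfl, rfl, rfl, rfl⟩ :=
      exists_perm_quadruple ij.symm kl.symm jl jk il ik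
    have ha := (fst_ne_snd a).symm
    have hb := (fst_ne_snd b).symm
    refine evalWord_relabel_eq g (u := STVP.wY _ _ hb * STVP.wY _ _ ha)
      (v := STVP.wY _ _ ha * STVP.wY _ _ hb) ?_
    change y _ _ hb * y _ _ ha = y _ _ ha * y _ _ hb
    refine (mul_comm_iff_of_involutions (ρ_sq b) (ρ_sq a) (ρ_far hab)
      (ρ_mul_y _ hab.swap_snd hab.swap_fst)
      (ρ_mul_y _ hab.symm.swap_snd hab.symm.swap_fst)).1 ?_
    rw [y_mul_ρ, y_mul_ρ]
    exact mk_eq (.tau_far b a hab)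
  | lam_y i j k l ij kl ik il jk jl =>
    obtain ⟨a, b, g, hab, rfl, rfl, rfl, rfl⟩ :=
      exists_perm_quadruple ij kl.symm il ik jl jk
    have ha := fst_ne_snd a
    have hb := (fst_ne_snd b).symm
    refine evalWord_relabel_eq g (u := STVP.wL _ _ ha * STVP.wY _ _ hb)
      (v := STVP.wY _ _ hb * STVP.wL _ _ ha) ?_
    change lam _ _ ha * y _ _ hb = y _ _ hb * lam _ _ ha
    refine commute_of_mul_eq_one (lamInv_mul_lam _) (lam_mul_lamInv _) ?_
    refine (mul_comm_iff_of_involutions (ρ_sq a) (ρ_sq b) (ρ_far hab)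
      (ρ_mul_y _ hab.swap_snd hab.swap_fst)
      (ρ_mul_lamInv _ hab.symm.swap_fst hab.symm.swap_snd)).1 ?_
    rw [lamInv_mul_ρ, y_mul_ρ]
    exact mk_eq (.sigma_tau_far a b hab)
  | lam_lam_y i j k ij ki kj =>
    -- The order `k, j, i` keeps both λ ascending and makes `y_{ij}` descending.
    obtain ⟨a, b, g, hab, rfl, rfl, rfl⟩ := exists_perm_triple kj ki ij.symm
    have h1 := fst_ne_snd a
    have h2 := fst_ne_snd_of_succ hab
    have h3 := snd_ne_snd_of_succ hab
    refine evalWord_relabel_eq g (u := STVP.wL _ _ h2 * (STVP.wL _ _ h1 * STVP.wY _ _ h3.symm))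
      (v := (STVP.wY _ _ h3.symm * STVP.wL _ _ h1) * STVP.wL _ _ h2) ?_
    change lam _ _ h2 * lam _ _ h1 * y _ _ h3.symm = (y _ _ h3.symm * lam _ _ h1) * lam _ _ h2
    have key : lamInv _ _ h1 * lamInv _ _ h2 * y _ _ h3.symm =
        y _ _ h3.symm * lamInv _ _ h2 * lamInv _ _ h1 := by
      refine (mul_mul_iff_of_involutions (ρ_sq a) (ρ_sq b) (ρ_braid hab)
        (ρ_mul_lamInv (h := h3) h2 (swap_snd_snd a) (swap_snd_of_succ hab))
        (ρ_mul_y (h := h1.symm) h2.symm (swap_mid_of_succ hab) (swap_fst_of_succ hab))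
        (ρ_mul_y (h := h2.symm) h3.symm (swap_snd_of_succ hab) (swap_fst_fst a))
        (ρ_mul_lamInv (h := h1) h2 (swap_fst_of_succ hab) (swap_mid_of_succ hab))
        (ρ_mul_lamInv (h := h3) h2 (swap_snd_snd a) (swap_snd_of_succ hab))
        (ρ_mul_lamInv (h := h2) h1 (swap_fst_of_succ hab) (swap_snd_mid_of_succ hab))).1 ?_
      have e1 := lamInv_mul_ρ b
      have e2 := y_mul_ρ b
      simp only [fst_eq_snd_of_succ hab] at e1 e2
      rw [lamInv_mul_ρ, e1, e2, y_mul_ρ]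
      exact mk_eq (.sigma_sigma_tau a b hab)
    rw [mul_assoc (y _ _ _)]
    exact ((mul_mul_inverses_iff (lamInv_mul_lam h1) (lamInv_mul_lam h2) (lam_mul_lamInv h1)
      (lam_mul_lamInv h2)).1 key).symm
  | y_lam k l kl =>
    obtain ⟨a, g, rfl, rfl⟩ := exists_perm_pair kl
    have h1 := fst_ne_snd a
    refine evalWord_relabel_eq g (u := STVP.wY _ _ h1 * STVP.wL _ _ h1.symm)
      (v := STVP.wL _ _ h1 * STVP.wY _ _ h1.symm) ?_
    change y _ _ h1 * lam _ _ h1.symm = lam _ _ h1 * y _ _ h1.symm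
    refine (mul_inverse_iff (lamInv_mul_lam _) (lamInv_mul_lam _) (lam_mul_lamInv _)
      (lam_mul_lamInv _)).1 ?_
    refine (mul_comm_same_iff_of_involution (ρ_sq a)
      (ρ_mul_lamInv h1.symm (swap_fst_fst a) (swap_snd_snd a))
      (ρ_mul_y h1 (swap_snd_snd a) (swap_fst_fst a))).1 ?_
    rw [lamInv_mul_ρ, y_mul_ρ]
    exact mk_eq (.sigma_tau a)
  | y_lam_lam i j k ij ki kj =>
    -- The order `i, k, j` makes `y_{ki}` descending and both λ ascending.
    obtain ⟨a, b, g, hab, rfl, rfl, rfl⟩ := exists_perm_triple ki.symm ij kj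
    have h1 := fst_ne_snd a
    have h2 := fst_ne_snd_of_succ hab
    have h3 := snd_ne_snd_of_succ hab
    refine evalWord_relabel_eq g (u := STVP.wY _ _ h1.symm * (STVP.wL _ _ h3 * STVP.wL _ _ h2))
      (v := (STVP.wL _ _ h2 * STVP.wL _ _ h3) * STVP.wY _ _ h1.symm) ?_
    change y _ _ h1.symm * lam _ _ h3 * lam _ _ h2 = (lam _ _ h2 * lam _ _ h3) * y _ _ h1.symm
    rw [mul_assoc]
    refine (mul_mul_inverses_iff (lamInv_mul_lam h3) (lamInv_mul_lam h2) (lam_mul_lamInv h3)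
      (lam_mul_lamInv h2)).1 ?_
    refine (mul_mul_iff_of_involutions (ρ_sq b) (ρ_sq a) (ρ_braid hab).symm
      (ρ_mul_lamInv (h := h1) h2 (swap_fst_of_succ hab) (swap_mid_of_succ hab))
      (ρ_mul_y (h := h3.symm) h2.symm (swap_snd_of_succ hab) (swap_snd_snd a))
      (ρ_mul_y (h := h2.symm) h1.symm (swap_snd_mid_of_succ hab) (swap_fst_of_succ hab))
      (ρ_mul_lamInv (h := h3) h2 (swap_snd_snd a) (swap_snd_of_succ hab))
      (ρ_mul_lamInv (h := h1) h2 (swap_fst_of_succ hab) (swap_mid_of_succ hab))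
      (ρ_mul_lamInv (h := h2) h3 (swap_fst_fst a) (swap_snd_of_succ hab))).1 ?_
    have e1 := lamInv_mul_ρ b
    have e2 := y_mul_ρ b
    simp only [fst_eq_snd_of_succ hab] at e1 e2
    rw [lamInv_mul_ρ, e1, e2, y_mul_ρ]
    exact mk_eq (.sigma_sigma_tau' a b hab)
  | y_gamma i j k ij ki kj =>
    obtain ⟨a, b, g, hab, rfl, rfl, rfl⟩ := exists_perm_triple ij.symm kj.symm ki.symm
    have h1 := (fst_ne_snd a).symm
    have h2 := (fst_ne_snd_of_succ hab).symm
    have h3 := (snd_ne_snd_of_succ hab).symm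
    refine evalWord_relabel_eq g (u := STVP.wY _ _ h1 * STVP.wG (snd b))
      (v := STVP.wG (snd b) * STVP.wY _ _ h1) ?_
    change y _ _ h1 * γ (snd b) = γ (snd b) * y _ _ h1
    refine (mul_right_cancel_of_mul_eq_one (ρ_sq a)).1 ?_
    rw [mul_assoc, mul_assoc, y_mul_ρ, ← ρ_mul_γ_of_eq (Equiv.swap_apply_of_ne_of_ne h2 h3),
      ← mul_assoc, y_mul_ρ]
    exact mk_eq (.tau_gamma_far a _ h2 h3)
  | y_twist i j ij =>
    obtain ⟨a, g, rfl, rfl⟩ := exists_perm_pair ij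
    have h1 := fst_ne_snd a
    refine evalWord_relabel_eq g (u := STVP.wY _ _ h1)
      (v := STVP.wG _ * STVP.wG _ * STVP.wY _ _ h1.symm * STVP.wG _ * STVP.wG _) ?_
    refine (twist_iff_of_involution (ρ_sq a)
      (ρ_mul_y h1 (swap_snd_snd a) (swap_fst_fst a))
      (ρ_mul_γ_of_eq (swap_fst_fst a)) (ρ_mul_γ_of_eq (swap_snd_snd a))
      (mk_eq (.gamma_comm _ _))).1 ?_
    rw [y_mul_ρ]
    exact mk_eq (.tau_twist a)

end STVB

/-! ### Injectivity, and surjectivity onto the kernel -/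

namespace STVB

variable {n : ℕ}

/-- The homomorphism from the presented monoid, sending each letter to the element it names. -/
def evalHom (n : ℕ) : PresentedMonoid (STVP.Rel n) →* STVB n :=
  PresentedMonoid.lift evalGen evalGen_rel

/-- The coset action of the singular twisted virtual braid monoid on the presented monoid. -/
def opHom (n : ℕ) : STVB n →* Function.End (PresentedMonoid (STVP.Rel n)) :=
  PresentedMonoid.lift STVP.opGen STVP.opGen_rel

theorem ρ_mul_evalHom (i : Fin (n - 1)) (a : PresentedMonoid (STVP.Rel n)) :
    ρ i * evalHom n a = evalHom n (adjSwap i • a) * ρ i := by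
  have h : a ∈ Submonoid.closure (Set.range (PresentedMonoid.of (STVP.Rel n))) := by
    rw [PresentedMonoid.closure_range_of]
    trivial
  induction h using Submonoid.closure_induction with
  | mem x hx =>
    obtain ⟨x, rfl⟩ := hx
    exact ρ_mul_evalGen i x
  | one => simp
  | mul a b _ _ ha hb => rw [smul_mul', map_mul, map_mul, ← mul_assoc, ha, mul_assoc, hb, mul_assoc]

/-- An induction principle for the elements `x_{kl}`: every pair is reached from a neighbouring one
by adjacent transpositions, each realised by conjugation with some `ρ i`. -/
theorem spread_of_mul {P : (k l : Fin n) → k ≠ l → STVB n → Prop} (a : Fin (n - 1) → STVB n)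
    (ha : ∀ i, P (fst i) (snd i) (fst_ne_snd i) (a i))
    (hP : ∀ i k l h x, P k l h x →
      P (adjSwap i k) (adjSwap i l) ((adjSwap i).injective.ne h) (ρ i * x * ρ i))
    (had : IsAdjacentFamily (n - 1) (natExt (ρ (n := n))) (natExt a)) (k l : Fin n) (h : k ≠ l) :
    P k l h (spread a k l h) := by
  have key : ∀ g : Equiv.Perm (Fin n), ∀ k l h, P k l h (spread a k l h) →
      P (g k) (g l) (g.injective.ne h) (spread a (g k) (g l) (g.injective.ne h)) := by
    intro g
    have hg : g ∈ Submonoid.closure (Set.range (adjSwap (n := n))) := by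
      rw [closure_adjSwap]
      trivial
    induction hg using Submonoid.closure_induction with
    | mem x hx =>
      obtain ⟨i, rfl⟩ := hx
      intro k l h hp
      rw [← (conj_eq_iff_of_sq (ρ_sq i)).2 (ρ_mul_spread had i h)]
      exact hP i k l h _ hp
    | one => exact fun k l h hp => hp
    | mul x y _ _ hx hy => exact fun k l h hp => hx _ _ _ (hy k l h hp)
  obtain ⟨i, g, rfl, rfl⟩ := exists_perm_pair h
  refine key g _ _ (fst_ne_snd i) ?_
  rw [spread_fst_snd]
  exact ha i

theorem opHom_ρ (i : Fin (n - 1)) : opHom n (ρ i) = STVP.opP (adjSwap i) := rfl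

theorem opHom_conj (i : Fin (n - 1)) (x : STVB n) (a : PresentedMonoid (STVP.Rel n))
    (h : opHom n x = STVP.opL a) : opHom n (ρ i * x * ρ i) = STVP.opL (adjSwap i • a) := by
  rw [map_mul, map_mul, h, opHom_ρ, STVP.opP_mul_opL rfl, mul_assoc, STVP.opP_adjSwap_sq, mul_one]

/-- Pure elements act on the presented monoid by left multiplication. -/
theorem opHom_evalGen (x : STVP.Gen n) :
    opHom n (evalGen x) = STVP.opL (PresentedMonoid.of (STVP.Rel n) x) := by
  cases x with
  | lam k l h =>
    refine spread_of_mul (P := fun k l h x => opHom n x = STVP.opL (STVP.L k l h)) _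
      (fun i => ?_) (fun i k l h x hx => opHom_conj i x _ hx) isAdjacentFamily_lam k l h
    change STVP.opP (adjSwap i) * (STVP.opP (adjSwap i) * _) = _
    rw [← mul_assoc, STVP.opP_adjSwap_sq, one_mul]
  | lamInv k l h =>
    refine spread_of_mul (P := fun k l h x => opHom n x = STVP.opL (STVP.Li k l h)) _
      (fun i => ?_) (fun i k l h x hx => opHom_conj i x _ hx) isAdjacentFamily_lamInv k l h
    change STVP.opL (STVP.Li (fst i) (snd i) (fst_ne_snd i)) * STVP.opP (adjSwap i) *
      STVP.opP (adjSwap i) = _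
    rw [mul_assoc, STVP.opP_adjSwap_sq, mul_one]
  | y k l h =>
    refine spread_of_mul (P := fun k l h x => opHom n x = STVP.opL (STVP.Y k l h)) _
      (fun i => ?_) (fun i k l h x hx => opHom_conj i x _ hx) isAdjacentFamily_y k l h
    change STVP.opP (adjSwap i) *
      (STVP.opL (STVP.Y (snd i) (fst i) (fst_ne_snd i).symm) * STVP.opP (adjSwap i)) = _
    rw [← mul_assoc, STVP.opP_mul_Y (fst_ne_snd i) (swap_snd_snd i) (swap_fst_fst i), mul_assoc,
      STVP.opP_adjSwap_sq, mul_one]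
  | gamma j => rfl

theorem opHom_comp_evalHom : (opHom n).comp (evalHom n) = STVP.opL :=
  PresentedMonoid.ext _ opHom_evalGen

/-- The action recovers `a` from its image, as the value at `1` of left multiplication by `a`. -/
theorem evalHom_injective : Function.Injective (evalHom n) := by
  intro a b h
  have e : STVP.opL a = STVP.opL b := by
    rw [← opHom_comp_evalHom, MonoidHom.comp_apply, h, MonoidHom.comp_apply]
  have := congrFun e 1
  change a * 1 = b * 1 at this
  simpa using this

theorem φ₁_evalGen (x : STVP.Gen n) : φ₁ n (evalGen x) = 1 := by
  have hP : ∀ (i : Fin (n - 1)) (k l : Fin n) (_ : k ≠ l) (x : STVB n), φ₁ n x = 1 →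
      φ₁ n (ρ i * x * ρ i) = 1 := by
    intro i _ _ _ x hx
    rw [map_mul, map_mul, hx, mul_one]
    exact Equiv.swap_mul_self _ _
  cases x with
  | lam k l h =>
    exact spread_of_mul (P := fun k l h x => φ₁ n x = 1) _
      (fun i => Equiv.swap_mul_self _ _) hP isAdjacentFamily_lam k l h
  | lamInv k l h =>
    exact spread_of_mul (P := fun k l h x => φ₁ n x = 1) _
      (fun i => Equiv.swap_mul_self _ _) hP isAdjacentFamily_lamInv k l h
  | y k l h =>
    exact spread_of_mul (P := fun k l h x => φ₁ n x = 1) _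
      (fun i => Equiv.swap_mul_self _ _) hP isAdjacentFamily_y k l h
  | gamma j => rfl

theorem φ₁_evalHom (a : PresentedMonoid (STVP.Rel n)) : φ₁ n (evalHom n a) = 1 :=
  DFunLike.congr_fun (show (φ₁ n).comp (evalHom n) = 1 from PresentedMonoid.ext _ φ₁_evalGen) a

theorem ρ_mem (i : Fin (n - 1)) : ρ i ∈ initialSubmonoid (natExt (ρ (n := n))) (n - 1) := by
  rw [← natExt_val ρ i]
  exact mem_initialSubmonoid _ i.2

/-- Every element is a pure element followed by a product of the `ρ i`. -/
theorem exists_eq_evalHom_mul (w : STVB n) :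
    ∃ a, ∃ r ∈ initialSubmonoid (natExt (ρ (n := n))) (n - 1), w = evalHom n a * r := by
  have h : w ∈ Submonoid.closure (Set.range (PresentedMonoid.of (Rel n))) := by
    rw [PresentedMonoid.closure_range_of]
    trivial
  -- Generators are added on the left: each is a pure letter and at most one `ρ i`, and the `ρ i`
  -- crosses the pure part by renumbering it.
  induction h using Submonoid.closure_induction_left with
  | one => exact ⟨1, 1, one_mem _, by simp⟩
  | mul_left x hx w _ ih =>
    obtain ⟨x, rfl⟩ := hx
    obtain ⟨a, r, hr, rfl⟩ := ih
    have hρ : ∀ i b, ρ i * (evalHom n b * r) = evalHom n (adjSwap i • b) * (ρ i * r) := by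
      intro i b
      rw [← mul_assoc, ρ_mul_evalHom, mul_assoc]
    cases x with
    | sigma i =>
      refine ⟨STVP.Li _ _ (fst_ne_snd i) * adjSwap i • a, ρ i * r, mul_mem (ρ_mem i) hr, ?_⟩
      change σ i * (evalHom n a * r) = _
      rw [map_mul, mul_assoc, ← hρ, ← lamInv_mul_ρ, mul_assoc]
      rfl
    | sigmaInv i =>
      refine ⟨adjSwap i • (STVP.L _ _ (fst_ne_snd i) * a), ρ i * r, mul_mem (ρ_mem i) hr, ?_⟩
      change σInv i * (evalHom n a * r) = _
      rw [← hρ, map_mul, mul_assoc (evalHom n _), ← ρ_mul_lam_fst_snd, mul_assoc]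
      rfl
    | rho i => exact ⟨adjSwap i • a, ρ i * r, mul_mem (ρ_mem i) hr, hρ i a⟩
    | tau i =>
      refine ⟨STVP.Y _ _ (fst_ne_snd i).symm * adjSwap i • a, ρ i * r, mul_mem (ρ_mem i) hr, ?_⟩
      change τ i * (evalHom n a * r) = _
      rw [map_mul, mul_assoc, ← hρ, ← y_mul_ρ, mul_assoc]
      rfl
    | gamma j =>
      refine ⟨STVP.G j * a, r, hr, ?_⟩
      rw [map_mul, mul_assoc]
      rfl

/-- A product of the `ρ i` in the kernel is trivial. -/
theorem eq_one_of_φ₁_eq_one {r : STVB n}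
    (hr : r ∈ initialSubmonoid (natExt (ρ (n := n))) (n - 1)) (h : φ₁ n r = 1) : r = 1 := by
  -- The Coxeter argument takes place on ℕ, so permutations of the strands are extended by the
  -- identity.
  let ι : Fin n ↪ ℕ := Fin.valEmbedding
  refine isCoxeterA_ρ.eq_one_of_perm_eq_one ((Equiv.Perm.viaEmbeddingHom ι).comp (φ₁ n)) ?_ _
    le_rfl r hr (by rw [MonoidHom.comp_apply, h, map_one])
  intro i hi j hj
  have := Equiv.Perm.viaEmbedding_apply (adjSwap (n := n) ⟨i, hi⟩) ι ⟨j, by omega⟩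
  rw [natExt_of_lt _ hi]
  exact this.trans (coe_adjSwap _ _)

theorem exists_evalHom_eq {w : STVB n} (h : φ₁ n w = 1) : ∃ a, evalHom n a = w := by
  obtain ⟨a, r, hr, rfl⟩ := exists_eq_evalHom_mul w
  rw [map_mul, φ₁_evalHom, one_mul] at h
  exact ⟨a, by rw [eq_one_of_φ₁_eq_one hr h, mul_one]⟩

end STVB

/-- The kernel of `φ₁` is presented by the generators `λ_{kl}^{±1}`, `y_{kl}`, `γ_j` and the
relations `STVP.Rel n`: sending each letter to the element of the same name is an isomorphism from
the monoid so presented onto the kernel. -/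
theorem mainTheorem1 (n : ℕ) :
    ∃ e : PresentedMonoid (STVP.Rel n) ≃* STVP n,
      (∀ (k l : Fin n) (h : k ≠ l),
        (e (PresentedMonoid.of (STVP.Rel n) (STVP.Gen.lam k l h)) : STVB n) = STVB.lam k l h) ∧
      (∀ (k l : Fin n) (h : k ≠ l),
        (e (PresentedMonoid.of (STVP.Rel n) (STVP.Gen.lamInv k l h)) : STVB n)
          = STVB.lamInv k l h) ∧
      (∀ (k l : Fin n) (h : k ≠ l),
        (e (PresentedMonoid.of (STVP.Rel n) (STVP.Gen.y k l h)) : STVB n) = STVB.y k l h) ∧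
      (∀ j : Fin n,
        (e (PresentedMonoid.of (STVP.Rel n) (STVP.Gen.gamma j)) : STVB n) = STVB.γ j) := by
  let f : PresentedMonoid (STVP.Rel n) →* STVP n :=
    (STVB.evalHom n).codRestrict (STVP n) STVB.φ₁_evalHom
  have hf : Function.Bijective f := by
    refine ⟨fun a b h => STVB.evalHom_injective (congrArg Subtype.val h), ?_⟩
    rintro ⟨w, hw⟩
    obtain ⟨a, ha⟩ := STVB.exists_evalHom_eq (MonoidHom.mem_mker.1 hw)
    exact ⟨a, Subtype.ext ha⟩
  exact ⟨MulEquiv.ofBijective f hf, fun _ _ _ => rfl, fun _ _ _ => rfl, fun _ _ _ => rfl,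
    fun _ => rfl⟩
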